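/- All manifolds are smooth, connected, Hausdorff, second countable and without boundary; $\mathfrak n\ge 1$. **Setting.** Null hypersurface data $\{\mathcal N,\gamma,\boldsymbol\ell,\ell^{(2)},\mathbf Y\}$ consist of an $\mathfrak n$-manifold $\mathcal N$, smooth symmetric $(0,2)$-tensors $\gamma$ (of signature $(0,+,\dots,+)$) and $\mathbf Y$, a smooth one-form $\boldsymbol\ell$ and a smooth function $\ell^{(2)}$ such that the bilinear form $\mathcal A((W,a),(Z,b))=\gamma(W,Z)+a\boldsymbol\ell(Z)+b\boldsymbol\ell(W)+ab\,\ell^{(2)}$ on $T_p\mathcal N\times\mathbb R$ is non-degenerate for all $p$. Let $n$ be the vector field determined by $\mathcal A^{-1}((\boldsymbol\beta,a),(0,1))=\boldsymbol\beta(n)$ (so $\gamma(n,\cdot)=0$, $\boldsymbol\ell(n)=1$), and put $\mathbf F=\frac12 d\boldsymbol\ell$, $\boldsymbol s=\mathbf F(n,\cdot)$, $\mathbf U=\frac12\pounds_n\gamma$, $\boldsymbol r=\mathbf Y(n,\cdot)$, $\kappa_n=-\mathbf Y(n,n)$. Let $\overset{\circ}{\nabla}$ be the torsion-free connection determined by $\overset{\circ}{\nabla}_a\gamma_{bc}=-\ell_b\mathrm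 U_{ac}-\ell_c\mathrm U_{ab}$ and $\overset{\circ}{\nabla}_a\ell_b=\mathrm F_{ab}-\ell^{(2)}\mathrm U_{ab}$, and let $\overline\nabla_XW=\overset{\circ}{\nabla}_XW-\mathbf Y(X,W)\,n$. Let $\overline\eta$ be a smooth vector field on $\mathcal N$, $\alpha=\boldsymbol\ell(\overline\eta)$, so that $\overline\eta=\alpha n$ if $\overline\eta\in\mathrm{Rad}\,\gamma$. Let $\overline\Sigma=\pounds_{\overline\eta}\overline\nabla$, i.e. $\overline\Sigma(X,W)=\pounds_{\overline\eta}\overline\nabla_XW-\overline\nabla_X\pounds_{\overline\eta}W-\overline\nabla_{\pounds_{\overline\eta}X}W$, and set $$\mathcal E_{ab}=\overset{\circ}{\nabla}_a\overset{\circ}{\nabla}_b\alpha+2(\overset{\circ}{\nabla}_{(a}\alpha)(s_{b)}-r_{b)})+2\alpha\overset{\circ}{\nabla}_{(a}s_{b)}+n(\alpha)\mathrm Y_{ab}-\alpha\pounds_n\mathrm Y_{ab},$$ $$\mathcal W=\alpha\pounds_n(\boldsymbol s-\boldsymbol r)+d(n(\alpha))+\kappa_n\,d\alpha.$$ The data with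 $\overline\eta$ are an *AKH$_0$* if $\overline\eta\in\mathrm{Rad}\,\gamma$, the zero set of $\overline\eta$ has empty interior and $\pounds_{\overline\eta}\gamma=0$; an *AKH$_1$* if moreover $\mathcal E=0$; an *AWKH$_1$* if they are an AKH$_0$ and $\mathcal W=0$. A spacetime $(\mathcal M,g)$ is an $(\mathfrak n+1)$-manifold with a smooth Lorentzian metric, with Levi-Civita connection $\nabla$. The data are embedded in $(\mathcal M,g)$ with embedding $\phi:\mathcal N\to\mathcal M$ and rigging $\zeta$ (a smooth vector field along $\phi$, everywhere transverse to $\phi(\mathcal N)$) if $\phi^\star g=\gamma$, $\phi^\star(g(\zeta,\cdot))=\boldsymbol\ell$, $\phi^\star(g(\zeta,\zeta))=\ell^{(2)}$ and $\frac12\phi^\star(\pounds_\zeta g)=\mathbf Y$. An embedded null hypersurface $\widetilde{\mathcal N}=\phi(\mathcal N)$ is a *non-expanding horizon* if its second fundamental form vanishes and it is diffeomorphic to a product $S\times\mathbb R$ with the null generators along $\mathbb R$. A non-expanding horizon with a nowhere vanishing null tangent vector field $\eta=\phi_\star\overline\eta$ is *weakly isolated* if $\pounds_\eta\boldsymbol\varpi=0$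 for a one-form $\boldsymbol\varpi$ on $\widetilde{\mathcal N}$ with $\nabla_X\eta=\boldsymbol\varpi(X)\eta$ for all tangent $X$, and *isolated* if $[\pounds_\eta,\overline\nabla_a]=0$, where $\overline\nabla$ is the connection induced on $\widetilde{\mathcal N}$ by $\nabla$. **Claims.** The connection $\overset{\circ}{\nabla}$ exists, and: 1. If $\mathbf U=0$ and $\overline\eta\in\mathrm{Rad}\,\gamma$, then $\overline\Sigma^c{}_{ab}=\mathcal E_{ab}\,n^c$; in particular $\overline\Sigma=0$ if and only if $\mathcal E=0$. Every AKH$_0$ has $\mathbf U=0$, and an AKH$_0$ is an AKH$_1$ if and only if $\overline\Sigma=0$. Let now the data be embedded in a spacetime $(\mathcal M,g)$ with embedding $\phi$ and rigging $\zeta$. 2. If $\mathbf U=0$, then $\overline\nabla=\overset{\circ}{\nabla}-\mathbf Y\,n$ is the connection induced on $\phi(\mathcal N)$ by $\nabla$. 3. $\phi(\mathcal N)$ with $\phi_\star\overline\eta$ is an isolated horizon if and only if the data with $\overline\eta$ are an AKH$_1$, $\mathcal N$ is diffeomorphic to a product $S\times\mathbb R$ with the null generators (the curves tangent to $\mathrm{Rad}\,\gamma$)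 along $\mathbb R$, and $\overline\eta$ vanishes nowhere. 4. If $\mathbf U=0$ and $\overline\eta\in\mathrm{Rad}\,\gamma$, then there is a one-form $\boldsymbol\varpi$ with $\nabla_X\eta=\boldsymbol\varpi(X)\eta$ (for all $X$ tangent to $\phi(\mathcal N)$) away from the zeros of $\eta=\phi_\star\overline\eta$, and for any such $\boldsymbol\varpi$, at every point where $\alpha\ne0$, $$\phi^\star\boldsymbol\varpi=\frac{d\alpha}{\alpha}+\boldsymbol s-\boldsymbol r,\qquad \phi^\star(\pounds_\eta\boldsymbol\varpi)=\mathcal W;$$ in particular, $\pounds_\eta\boldsymbol\varpi=0$ at such a point if and only if $\mathcal W=0$ there. 5. $\phi(\mathcal N)$ with $\phi_\star\overline\eta$ is a weakly isolated horizon if and only if the data with $\overline\eta$ are an AWKH$_1$, $\mathcal N$ is diffeomorphic to a product $S\times\mathbb R$ with the null generators along $\mathbb R$, and $\overline\eta$ vanishes nowhere. -/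

import Mathlib

open Bundle VectorField
open scoped Manifold ContDiff

universe u v

namespace Horizons

noncomputable section

/-! ### Fields on a manifold -/

section Fields

/-- The model space `ℝᵏ`. -/
abbrev E (k : ℕ) : Type := EuclideanSpace ℝ (Fin k)

variable {k : ℕ} {N : Type*} [TopologicalSpace N] [ChartedSpace (E k) N]

/-- Vector fields on a `k`-dimensional manifold. -/
abbrev VF (k : ℕ) (N : Type*) [TopologicalSpace N] [ChartedSpace (E k) N] : Type _ :=
  ∀ p : N, TangentSpace (𝓡 k) p

/-- One-form fields. -/
abbrev OneForm (k : ℕ) (N : Type*) [TopologicalSpace N] [ChartedSpace (E k) N] : Type _ :=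
  ∀ p : N, TangentSpace (𝓡 k) p →L[ℝ] ℝ

/-- `(0,2)`-tensor fields. -/
abbrev TwoTensor (k : ℕ) (N : Type*) [TopologicalSpace N] [ChartedSpace (E k) N] : Type _ :=
  ∀ p : N, TangentSpace (𝓡 k) p →L[ℝ] TangentSpace (𝓡 k) p →L[ℝ] ℝ

/-- Smooth vector fields, i.e. elements of `Γ(TN)`. -/
def SmoothVF [IsManifold (𝓡 k) ∞ N] (X : VF k N) : Prop :=
  ContMDiff (𝓡 k) (𝓡 k).tangent ∞ (fun p => (⟨p, X p⟩ : TangentBundle (𝓡 k) N))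

/-- Smooth one-forms, as sections of the cotangent bundle. -/
def SmoothOneForm [IsManifold (𝓡 k) ∞ N] (θ : OneForm k N) : Prop :=
  ContMDiff (𝓡 k) ((𝓡 k).prod 𝓘(ℝ, E k →L[ℝ] ℝ)) ∞
    (fun p => TotalSpace.mk' (E k →L[ℝ] ℝ)
      (E := fun q : N => TangentSpace (𝓡 k) q →L[ℝ] Trivial N ℝ q) p (θ p))

/-- Smooth `(0,2)`-tensor fields, as sections of the corresponding bundle. -/
def SmoothTwoTensor [IsManifold (𝓡 k) ∞ N] (B : TwoTensor k N) : Prop :=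
  ContMDiff (𝓡 k) ((𝓡 k).prod 𝓘(ℝ, E k →L[ℝ] E k →L[ℝ] ℝ)) ∞
    (fun p => TotalSpace.mk' (E k →L[ℝ] E k →L[ℝ] ℝ)
      (E := fun q : N => TangentSpace (𝓡 k) q →L[ℝ] TangentSpace (𝓡 k) q →L[ℝ] Trivial N ℝ q)
      p (B p))

/-- The derivative `V(f)` of a function along a vector field; equivalently `df(V)`. -/
def dirDeriv (V : VF k N) (f : N → ℝ) (p : N) : ℝ := mvfderiv (𝓡 k) f p (V p)

/-- The Lie bracket `[V, W] = £_V W`. -/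
def bracket (V W : VF k N) : VF k N := fun p => mlieBracket (𝓡 k) V W p

/-- `(£_V θ)(X) = V(θ(X)) - θ([V, X])`. -/
def lieOneForm (V : VF k N) (θ : OneForm k N) (X : VF k N) (p : N) : ℝ :=
  dirDeriv V (fun q => θ q (X q)) p - θ p (bracket V X p)

/-- `(£_V B)(X, W) = V(B(X, W)) - B([V, X], W) - B(X, [V, W])`. -/
def lieTwoTensor (V : VF k N) (B : TwoTensor k N) (X W : VF k N) (p : N) : ℝ :=
  dirDeriv V (fun q => B q (X q) (W q)) p - B p (bracket V X p) (W p)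
    - B p (X p) (bracket V W p)

/-- `dθ(X, W) = X(θ(W)) - W(θ(X)) - θ([X, W])`. -/
def extD (θ : OneForm k N) (X W : VF k N) (p : N) : ℝ :=
  dirDeriv X (fun q => θ q (W q)) p - dirDeriv W (fun q => θ q (X q)) p - θ p (bracket X W p)

/-- The Lie derivative of a connection,
`(£_η ∇)(X, W) = £_η (∇_X W) - ∇_X (£_η W) - ∇_{£_η X} W`, where `D X W` stands for `∇_X W`. -/
def lieConnection (D : VF k N → VF k N → VF k N) (η X W : VF k N) : VF k N := fun p =>
  bracket η (D X W) p - D X (bracket η W) p - D (bracket η X) W p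

/-- `[£_η, ∇_a] = 0`: Lie derivative and covariant derivative commute, on vector fields
(`£_η (∇W) = ∇ (£_η W)` as `(1,1)`-tensors) and on one-forms (`£_η (∇θ) = ∇ (£_η θ)` as
`(0,2)`-tensors). All terms are evaluated on the vector fields `X` (derivative slot) and `W`. -/
def LieCommutes [IsManifold (𝓡 k) ∞ N] (D : VF k N → VF k N → VF k N) (η : VF k N) : Prop :=
  (∀ X W : VF k N, SmoothVF X → SmoothVF W → ∀ p,
    bracket η (D X W) p - D (bracket η X) W p = D X (bracket η W) p) ∧
  (∀ (θ : OneForm k N) (X W : VF k N), SmoothOneForm θ → SmoothVF X → SmoothVF W → ∀ p,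
    let nablaθ : VF k N → VF k N → N → ℝ := fun A B q =>
      dirDeriv A (fun z => θ z (B z)) q - θ q (D A B q)
    dirDeriv η (nablaθ X W) p - nablaθ (bracket η X) W p - nablaθ X (bracket η W) p
      = dirDeriv X (lieOneForm η θ W) p - lieOneForm η θ (D X W) p)

/-- Product topology: there is a `d`-manifold `S` and a diffeomorphism `S × ℝ ≃ N` under which the
curves `{s} × ℝ` are tangent to the given directions `R` (the null directions, so that the null
generators are along `ℝ`). -/
def HasProductTopology {d : ℕ} {N : Type u} [TopologicalSpace N] [ChartedSpace (E (d + 1)) N]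
    (R : ∀ p : N, Set (TangentSpace (𝓡 (d + 1)) p)) : Prop :=
  ∃ (S : Type u) (_ : TopologicalSpace S) (_ : ChartedSpace (E d) S),
    IsManifold (𝓡 d) ∞ S ∧
    ∃ Ψ : Diffeomorph ((𝓡 d).prod 𝓘(ℝ, ℝ)) (𝓡 (d + 1)) (S × ℝ) N ∞,
      ∀ (s : S) (t : ℝ),
        mfderiv 𝓘(ℝ, ℝ) (𝓡 (d + 1)) (fun t' : ℝ => Ψ (s, t')) t (1 : ℝ) ∈ R (Ψ (s, t))

end Fields

/-! ### Null hypersurface data -/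

section Data

/-- The bilinear form
`𝒜((W,a),(Z,b)) = γ(W,Z) + a ℓ(Z) + b ℓ(W) + a b ℓ⁽²⁾` on `V × ℝ`. -/
def ambientForm {V : Type*} [AddCommGroup V] [Module ℝ V] [TopologicalSpace V]
    (γ : V →L[ℝ] V →L[ℝ] ℝ) (l : V →L[ℝ] ℝ) (c : ℝ) : LinearMap.BilinForm ℝ (V × ℝ) :=
  LinearMap.mk₂ ℝ (fun x y => γ x.1 y.1 + x.2 * l y.1 + y.2 * l x.1 + x.2 * y.2 * c)
    (by intros; simp; ring) (by intros; simp; ring) (by intros; simp; ring)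
    (by intros; simp; ring)

/-- Null hypersurface data `{N, γ, ℓ, ℓ⁽²⁾, Y}` of dimension `m`. -/
structure NullData (m : ℕ) (N : Type*) [TopologicalSpace N] [ChartedSpace (E m) N]
    [IsManifold (𝓡 m) ∞ N] where
  γ : TwoTensor m N
  ell : OneForm m N
  ell2 : N → ℝ
  Y : TwoTensor m N
  γ_smooth : SmoothTwoTensor γ
  ell_smooth : SmoothOneForm ell
  ell2_smooth : ContMDiff (𝓡 m) 𝓘(ℝ, ℝ) ∞ ell2
  Y_smooth : SmoothTwoTensor Y
  γ_symm : ∀ p v w, γ p v w = γ p w v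
  Y_symm : ∀ p v w, Y p v w = Y p w v
  /-- `γ` has signature `(0,+,…,+)`: it is positive semidefinite with one-dimensional radical. -/
  γ_nonneg : ∀ p v, 0 ≤ γ p v v
  γ_rad : ∀ p, Module.finrank ℝ (LinearMap.ker (γ p).toLinearMap) = 1
  nondeg : ∀ p, (ambientForm (γ p) (ell p) (ell2 p)).Nondegenerate

namespace NullData

variable {m : ℕ} {N : Type*} [TopologicalSpace N] [ChartedSpace (E m) N] [IsManifold (𝓡 m) ∞ N]

/-- The radical of `γ`. -/
def rad (D : NullData m N) (p : N) : Set (TangentSpace (𝓡 m) p) :=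
  {v | ∀ w, D.γ p v w = 0}

/-- The vector field `n` read off from the inverse of `𝒜`: for the covector `(0, 1)` one has
`𝒜⁻¹((0,1), (α,a)) = n(α)`, i.e. `n` is the `TN`-component of the vector dual to `(0, 1)`. -/
def n (D : NullData m N) : VF m N := fun p =>
  haveI : FiniteDimensional ℝ (TangentSpace (𝓡 m) p) :=
    inferInstanceAs (FiniteDimensional ℝ (E m))
  (((ambientForm (D.γ p) (D.ell p) (D.ell2 p)).toDual (D.nondeg p)).symm
    (LinearMap.snd ℝ (TangentSpace (𝓡 m) p) ℝ)).1

/-- `F = ½ dℓ`. -/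
def F (D : NullData m N) (X W : VF m N) (p : N) : ℝ := (1 / 2) * extD D.ell X W p

/-- `s = F(n, ·)`. -/
def s (D : NullData m N) (X : VF m N) (p : N) : ℝ := D.F D.n X p

/-- `U = ½ £_n γ`. -/
def U (D : NullData m N) (X W : VF m N) (p : N) : ℝ := (1 / 2) * lieTwoTensor D.n D.γ X W p

/-- `r = Y(n, ·)`. -/
def r (D : NullData m N) (X : VF m N) (p : N) : ℝ := D.Y p (D.n p) (X p)

/-- `κ_n = -Y(n, n)`. -/
def kappa (D : NullData m N) (p : N) : ℝ := - D.Y p (D.n p) (D.n p)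

/-- The tensor `U` vanishes identically. -/
def UVanishes (D : NullData m N) : Prop :=
  ∀ X W : VF m N, SmoothVF X → SmoothVF W → ∀ p, D.U X W p = 0

/-- The defining properties of the metric hypersurface connection: it is a torsion-free
connection with `∇_a γ_bc = - ℓ_b U_ac - ℓ_c U_ab` and `∇_a ℓ_b = F_ab - ℓ⁽²⁾ U_ab`.
Here `cov W p v` is `(∇_v W)(p)`. -/
structure IsMetricConnection (D : NullData m N)
    (cov : VF m N → ∀ p : N, TangentSpace (𝓡 m) p →L[ℝ] TangentSpace (𝓡 m) p) : Prop where
  isCov : IsCovariantDerivativeOn (E m) cov Set.univ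
  torsionFree : ∀ X W : VF m N, SmoothVF X → SmoothVF W → ∀ p,
    cov W p (X p) - cov X p (W p) = bracket X W p
  nabla_γ : ∀ A B C : VF m N, SmoothVF A → SmoothVF B → SmoothVF C → ∀ p,
    dirDeriv A (fun q => D.γ q (B q) (C q)) p
        - D.γ p (cov B p (A p)) (C p) - D.γ p (B p) (cov C p (A p))
      = - D.ell p (B p) * D.U A C p - D.ell p (C p) * D.U A B p
  nabla_ell : ∀ A B : VF m N, SmoothVF A → SmoothVF B → ∀ p,
    dirDeriv A (fun q => D.ell q (B q)) p - D.ell p (cov B p (A p))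
      = D.F A B p - D.ell2 p * D.U A B p

/-- The metric hypersurface connection `∇°`: the connection determined by `IsMetricConnection`. -/
def conn (D : NullData m N) :
    VF m N → ∀ p : N, TangentSpace (𝓡 m) p →L[ℝ] TangentSpace (𝓡 m) p :=
  Classical.epsilon D.IsMetricConnection

/-- `∇°_X W`. -/
def nab (D : NullData m N) (X W : VF m N) : VF m N := fun p => D.conn W p (X p)

/-- `∇̄_X W = ∇°_X W - Y(X, W) n`. -/
def nabBar (D : NullData m N) (X W : VF m N) : VF m N := fun p =>
  D.nab X W p - D.Y p (X p) (W p) • D.n p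

/-- `Σ̄ = £_η ∇̄`. -/
def sigmaBar (D : NullData m N) (η X W : VF m N) : VF m N := lieConnection D.nabBar η X W

/-- `(∇°_X s)(W)`. -/
def nabS (D : NullData m N) (X W : VF m N) (p : N) : ℝ :=
  dirDeriv X (D.s W) p - D.s (D.nab X W) p

/-- The function `α` with `η = α n`, for `η` in the radical of `γ` (recall `ℓ(n) = 1`). -/
def alpha (D : NullData m N) (η : VF m N) : N → ℝ := fun p => D.ell p (η p)

/-- The tensor
`∇°_a ∇°_b α + 2 (∇°_(a α)(s_b) - r_b)) + 2 α ∇°_(a s_b) + n(α) Y_ab - α £_n Y_ab`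
contracted with `X^a W^b`. -/
def akh1Expr (D : NullData m N) (α : N → ℝ) (X W : VF m N) (p : N) : ℝ :=
  (dirDeriv X (dirDeriv W α) p - dirDeriv (D.nab X W) α p)
    + (dirDeriv X α p * (D.s W p - D.r W p) + dirDeriv W α p * (D.s X p - D.r X p))
    + α p * (D.nabS X W p + D.nabS W X p)
    + dirDeriv D.n α p * D.Y p (X p) (W p)
    - α p * lieTwoTensor D.n D.Y X W p

/-- The one-form `α £_n (s - r) + d(n(α)) + κ_n dα` contracted with `X`. -/
def awkh1Expr (D : NullData m N) (α : N → ℝ) (X : VF m N) (p : N) : ℝ :=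
  α p * (dirDeriv D.n (fun q => D.s X q - D.r X q) p
      - (D.s (bracket D.n X) p - D.r (bracket D.n X) p))
    + dirDeriv X (dirDeriv D.n α) p + D.kappa p * dirDeriv X α p

/-- Abstract Killing horizon of order zero with symmetry generator `η`. -/
structure IsAKH0 (D : NullData m N) (η : VF m N) : Prop where
  smooth : SmoothVF η
  mem_rad : ∀ p, η p ∈ D.rad p
  zeros : interior {p | η p = 0} = ∅
  lie_γ : ∀ X W : VF m N, SmoothVF X → SmoothVF W → ∀ p, lieTwoTensor η D.γ X W p = 0

/-- Abstract Killing horizon of order one. -/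
def IsAKH1 (D : NullData m N) (η : VF m N) : Prop :=
  D.IsAKH0 η ∧ ∀ X W : VF m N, SmoothVF X → SmoothVF W → ∀ p, D.akh1Expr (D.alpha η) X W p = 0

/-- Abstract weak Killing horizon of order one. -/
def IsAWKH1 (D : NullData m N) (η : VF m N) : Prop :=
  D.IsAKH0 η ∧ ∀ X : VF m N, SmoothVF X → ∀ p, D.awkh1Expr (D.alpha η) X p = 0

end NullData

end Data

/-! ### Spacetimes and embedded null hypersurfaces -/

section Spacetime

/-- A smooth Lorentzian metric of signature `(-,+,…,+)`. -/
structure LorentzMetric (k : ℕ) (M : Type*) [TopologicalSpace M] [ChartedSpace (E k) M]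
    [IsManifold (𝓡 k) ∞ M] where
  g : TwoTensor k M
  smooth : SmoothTwoTensor g
  symm : ∀ y v w, g y v w = g y w v
  lorentz : ∀ y, ∃ v, g y v v < 0 ∧ ∀ w, g y v w = 0 → w ≠ 0 → 0 < g y w w

variable {k : ℕ} {M : Type*} [TopologicalSpace M] [ChartedSpace (E k) M] [IsManifold (𝓡 k) ∞ M]

/-- The coordinate vector field `∂_μ` of the preferred chart at `y`. -/
def coordField (y : M) (μ : Fin k) : VF k M := fun z =>
  (trivializationAt (E k) (TangentSpace (𝓡 k)) y).symm z (EuclideanSpace.single μ 1)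

/-- The component `v^μ` of a tangent vector at `z` in the preferred chart at `y`. -/
def coordComp (y : M) (μ : Fin k) (z : M) (v : TangentSpace (𝓡 k) z) : ℝ :=
  (trivializationAt (E k) (TangentSpace (𝓡 k)) y (⟨z, v⟩ : TangentBundle (𝓡 k) M)).2 μ

namespace LorentzMetric

variable (g : LorentzMetric k M)

/-- The components `g_μν` in the preferred chart at `y`, as functions near `y`. -/
def comp (y : M) (z : M) : Matrix (Fin k) (Fin k) ℝ :=
  Matrix.of fun μ ν => g.g z (coordField y μ z) (coordField y ν z)

/-- `∂_σ g_μν` at `y`, in the preferred chart at `y`. -/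
def dcomp (y : M) (σ μ ν : Fin k) : ℝ :=
  dirDeriv (coordField y σ) (fun z => g.comp y z μ ν) y

/-- The Christoffel symbols
`Γ^μ_σρ = ½ g^μν (∂_σ g_ρν + ∂_ρ g_σν - ∂_ν g_σρ)` at `y`, in the preferred chart at `y`. -/
def christoffel (y : M) (μ σ ρ : Fin k) : ℝ :=
  (1 / 2) * ∑ ν, (g.comp y y)⁻¹ μ ν * (g.dcomp y σ ρ ν + g.dcomp y ρ σ ν - g.dcomp y ν σ ρ)

end LorentzMetric

variable {d : ℕ} {N : Type u} [TopologicalSpace N] [ChartedSpace (E (d + 1)) N]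
  [IsManifold (𝓡 (d + 1)) ∞ N]
  {M' : Type*} [TopologicalSpace M'] [ChartedSpace (E (d + 2)) M'] [IsManifold (𝓡 (d + 2)) ∞ M']

/-- Vector fields along a map `φ : N → M'`. -/
abbrev VFAlong (k : ℕ) {N M' : Type*} [TopologicalSpace M'] [ChartedSpace (E k) M']
    (φ : N → M') : Type _ :=
  ∀ p : N, TangentSpace (𝓡 k) (φ p)

/-- The push-forward `φ_* X`, as a vector field along `φ`. -/
def push (φ : N → M') (X : VF (d + 1) N) : VFAlong (d + 2) φ := fun p =>
  mfderiv (𝓡 (d + 1)) (𝓡 (d + 2)) φ p (X p)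

/-- The derivative `X(V^μ)` at `p` of a component of a vector field along `φ`, in the preferred
chart at `φ p`. -/
def dcompAlong (φ : N → M') (X : VF (d + 1) N) (V : VFAlong (d + 2) φ) (p : N) (μ : Fin (d + 2)) : ℝ :=
  dirDeriv X (fun q => coordComp (φ p) μ (φ q) (V q)) p

/-- The Levi-Civita derivative `∇_{φ_* X} V` of a vector field `V` along `φ`:
`(∇_{φ_* X} V)^μ = X(V^μ) + Γ^μ_σρ (φ_* X)^σ V^ρ`. -/
def covAlong (g : LorentzMetric (d + 2) M') (φ : N → M') (X : VF (d + 1) N) (V : VFAlong (d + 2) φ) :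
    VFAlong (d + 2) φ := fun p =>
  ∑ μ, (dcompAlong φ X V p μ + ∑ σ, ∑ ρ, g.christoffel (φ p) μ σ ρ
    * coordComp (φ p) σ (φ p) (push φ X p) * coordComp (φ p) ρ (φ p) (V p))
      • coordField (φ p) μ (φ p)

/-- `φ^*(£_ζ g)(X, W)` for a vector field `ζ` along `φ`, in the preferred chart at `φ p`:
`(ζ^σ ∂_σ g_μν) X^μ W^ν + g_μν X(ζ^μ) W^ν + g_μν X^μ W(ζ^ν)`.
Only derivatives of `ζ` tangent to `φ(N)` occur. -/
def pullLieMetric (g : LorentzMetric (d + 2) M') (φ : N → M') (ζ : VFAlong (d + 2) φ)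
    (X W : VF (d + 1) N) (p : N) : ℝ :=
  ∑ μ, ∑ ν,
    ((∑ σ, coordComp (φ p) σ (φ p) (ζ p) * g.dcomp (φ p) σ μ ν)
        * coordComp (φ p) μ (φ p) (push φ X p) * coordComp (φ p) ν (φ p) (push φ W p)
      + g.comp (φ p) (φ p) μ ν * dcompAlong φ X ζ p μ * coordComp (φ p) ν (φ p) (push φ W p)
      + g.comp (φ p) (φ p) μ ν * coordComp (φ p) μ (φ p) (push φ X p) * dcompAlong φ W ζ p ν)

/-- Null hypersurface data embedded in a spacetime with embedding `φ` and rigging `ζ`. -/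
structure IsEmbedded (D : NullData (d + 1) N) (g : LorentzMetric (d + 2) M') (φ : N → M')
    (ζ : VFAlong (d + 2) φ) : Prop where
  embedding : Manifold.IsSmoothEmbedding (𝓡 (d + 1)) (𝓡 (d + 2)) ∞ φ
  rig_smooth : ContMDiff (𝓡 (d + 1)) (𝓡 (d + 2)).tangent ∞
    (fun p => (⟨φ p, ζ p⟩ : TangentBundle (𝓡 (d + 2)) M'))
  transverse : ∀ p, ∀ v : TangentSpace (𝓡 (d + 1)) p,
    mfderiv (𝓡 (d + 1)) (𝓡 (d + 2)) φ p v ≠ ζ p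
  pull_γ : ∀ p (v w : TangentSpace (𝓡 (d + 1)) p),
    D.γ p v w = g.g (φ p) (mfderiv (𝓡 (d + 1)) (𝓡 (d + 2)) φ p v)
      (mfderiv (𝓡 (d + 1)) (𝓡 (d + 2)) φ p w)
  pull_ell : ∀ p (v : TangentSpace (𝓡 (d + 1)) p),
    D.ell p v = g.g (φ p) (ζ p) (mfderiv (𝓡 (d + 1)) (𝓡 (d + 2)) φ p v)
  pull_ell2 : ∀ p, D.ell2 p = g.g (φ p) (ζ p) (ζ p)
  pull_Y : ∀ X W : VF (d + 1) N, SmoothVF X → SmoothVF W → ∀ p,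
    D.Y p (X p) (W p) = (1 / 2) * pullLieMetric g φ ζ X W p

/-- Tangent vectors of `N` whose push-forward is normal (equivalently: null) to `φ(N)`. -/
def normalDirs (g : LorentzMetric (d + 2) M') (φ : N → M') (p : N) :
    Set (TangentSpace (𝓡 (d + 1)) p) :=
  {v | ∀ w : TangentSpace (𝓡 (d + 1)) p,
    g.g (φ p) (mfderiv (𝓡 (d + 1)) (𝓡 (d + 2)) φ p v)
      (mfderiv (𝓡 (d + 1)) (𝓡 (d + 2)) φ p w) = 0}

/-- `φ(N)` is an embedded null hypersurface: its first fundamental form is degenerate. -/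
def IsNullHypersurface (g : LorentzMetric (d + 2) M') (φ : N → M') : Prop :=
  Manifold.IsSmoothEmbedding (𝓡 (d + 1)) (𝓡 (d + 2)) ∞ φ ∧ ∀ p, ∃ v ∈ normalDirs g φ p, v ≠ 0

/-- Vanishing of the second fundamental form `K(X, W) = g(∇_X ν, W)` with respect to every null
normal `ν`. -/
def IsTotallyGeodesic (g : LorentzMetric (d + 2) M') (φ : N → M') : Prop :=
  ∀ ν X W : VF (d + 1) N, SmoothVF ν → SmoothVF X → SmoothVF W →
    (∀ p, ν p ∈ normalDirs g φ p) →
    ∀ p, g.g (φ p) (covAlong g φ X (push φ ν) p) (push φ W p) = 0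

/-- Non-expanding horizon. -/
def IsNEH (g : LorentzMetric (d + 2) M') (φ : N → M') : Prop :=
  IsNullHypersurface g φ ∧ IsTotallyGeodesic g φ ∧ HasProductTopology (normalDirs g φ)

/-- `φ_* η` is a null generator: tangent, null, smooth and nowhere zero. -/
def IsNullGenerator (g : LorentzMetric (d + 2) M') (φ : N → M') (η : VF (d + 1) N) : Prop :=
  SmoothVF η ∧ (∀ p, g.g (φ p) (push φ η p) (push φ η p) = 0) ∧ ∀ p, η p ≠ 0

/-- `ϖ` satisfies `∇_X η = ϖ(X) η` on the complement of the zero set of `η`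
(everything pulled back to `N`). -/
def IsVarpi (g : LorentzMetric (d + 2) M') (φ : N → M') (η : VF (d + 1) N)
    (ϖ : OneForm (d + 1) N) : Prop :=
  ∀ X : VF (d + 1) N, SmoothVF X → ∀ p, η p ≠ 0 →
    covAlong g φ X (push φ η) p = ϖ p (X p) • push φ η p

/-- `D` is the connection induced on `φ(N)` from the Levi-Civita connection:
`φ_*(D_X W) = ∇_{φ_* X} φ_* W`. -/
def IsInducedConnection (g : LorentzMetric (d + 2) M') (φ : N → M')
    (D : VF (d + 1) N → VF (d + 1) N → VF (d + 1) N) : Prop :=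
  ∀ X W : VF (d + 1) N, SmoothVF X → SmoothVF W → ∀ p,
    push φ (D X W) p = covAlong g φ X (push φ W) p

/-- Weakly isolated horizon with null generator `φ_* η`. -/
def IsWeaklyIsolated (g : LorentzMetric (d + 2) M') (φ : N → M') (η : VF (d + 1) N) : Prop :=
  IsNEH g φ ∧ IsNullGenerator g φ η ∧
    ∃ ϖ : OneForm (d + 1) N, IsVarpi g φ η ϖ ∧
      ∀ X : VF (d + 1) N, SmoothVF X → ∀ p, lieOneForm η ϖ X p = 0

/-- Isolated horizon with null generator `φ_* η`. -/
def IsIsolated (g : LorentzMetric (d + 2) M') (φ : N → M') (η : VF (d + 1) N) : Prop :=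
  IsNEH g φ ∧ IsNullGenerator g φ η ∧
    ∃ D : VF (d + 1) N → VF (d + 1) N → VF (d + 1) N,
      IsInducedConnection g φ D ∧ LieCommutes D η

end Spacetime

end

end Horizons

/-! Nondegeneracy of `𝒜` says that a tangent vector of `N` is determined by its contractions with
`γ` and with `ℓ` (`ext_γ_ell`). Every vector identity is therefore checked in two halves, a `γ`-half
and an `ℓ`-half.

Connection. The Koszul expression prescribes `γ(∇°_X W, Z)`, but `γ` kills `n` while the Koszul
expression at `Z = n` equals `-U(X, W)` (`koszul_n`). Adding `ℓ(Z) U(X, W)` removes the obstruction,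
and the condition on `∇°ℓ` fixes the `ℓ`-half. This gives existence
(`isMetricConnection_koszulConn`). Conversely the defining properties force both halves on smooth
fields (`γ_nab`, `ell_nab`), which is what makes the connection usable although it is obtained by
choice.

Lie derivative. Let `U = 0` and `η = α n`. Then `γ` is both parallel and invariant along `η`, so the
tensor `£_η ∇°`, lowered with `γ`, is symmetric in its first two slots and antisymmetric in its last
two; hence it vanishes (`γ_lieConnection_nab`). Moreover `∇°ℓ = F` has no symmetric part, so `ℓ(£_η
∇°)` is the symmetrised `∇°` derivative of `£_η ℓ = dα + 2α s` (`ell_lieConnection_nab`).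
Subtracting `£_η (Y ⊗ n)` gives `𝓔 n` (`sigmaBar_eq`). For an AKH₀, `0 = £_η γ = 2α U` on a dense
set where `α ≠ 0`, and continuity gives `U = 0`.

Embedded data. The coordinate definition of the Levi-Civita derivative enters only through
metricity, vanishing torsion and the formula for `φ^*(£_ζ g)`. Pairing `∇_X W` with tangent vectors
gives the Koszul expression, and pairing with the rigging gives the symmetrised derivative of `ℓ`
minus `Y`. For `U = 0` these are the two halves of `∇̄`, and `U = 0` is equivalent to vanishing
second fundamental form. Isolated horizons thus reduce to `Σ̄ = 0`. For weakly isolated ones, `∇̄_X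
η = (X(α) + α (s - r)(X)) n` yields `ϖ = dα/α + s - r`. Since `dα/α` is closed, its Lie derivative
along `η` is `d(n(α))`; the remaining terms come from `£_{αn}(s - r)` with `s(n) = 0` and `r(n) =
-κ_n`. -/

namespace Horizons

noncomputable section

/-! ### Calculus of smooth fields -/

section Calculus

variable {k : ℕ} {N : Type*} [TopologicalSpace N] [ChartedSpace (E k) N]

/-- Smooth real functions. -/
def SmoothFn (f : N → ℝ) : Prop := ContMDiff (𝓡 k) 𝓘(ℝ, ℝ) ∞ f

/-- Differentiability of a function at a point. -/
def DiffFn (f : N → ℝ) (p : N) : Prop := MDifferentiableAt (𝓡 k) 𝓘(ℝ, ℝ) f p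

/-- Differentiability of a vector field at a point. -/
def DiffVF [IsManifold (𝓡 k) ∞ N] (X : VF k N) (p : N) : Prop :=
  MDifferentiableAt (𝓡 k) (𝓡 k).tangent (fun q => (⟨q, X q⟩ : TangentBundle (𝓡 k) N)) p

instance isManifold_one [h : IsManifold (𝓡 k) ∞ N] : IsManifold (𝓡 k) 1 N :=
  IsManifold.of_le (n := ∞) (by simp)

instance isManifold_two [h : IsManifold (𝓡 k) ∞ N] : IsManifold (𝓡 k) 2 N :=
  IsManifold.of_le (n := ∞) (WithTop.coe_le_coe.2 (le_top : (2 : ℕ∞) ≤ ⊤))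

instance isManifold_three [h : IsManifold (𝓡 k) ∞ N] :
    IsManifold (𝓡 k) (minSmoothness ℝ 3) N :=
  IsManifold.of_le (n := ∞) (by
    rw [minSmoothness_of_isRCLikeNormedField]
    exact WithTop.coe_le_coe.2 (le_top : (3 : ℕ∞) ≤ ⊤))

instance isManifold_infty_add_one [h : IsManifold (𝓡 k) ∞ N] : IsManifold (𝓡 k) (∞ + 1) N :=
  IsManifold.of_le (n := ∞) (by simp)

section FunctionRules

variable {f g : N → ℝ} {p : N}

theorem SmoothFn.diff (hf : SmoothFn (k := k) f) (p : N) : DiffFn (k := k) f p :=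
  (ContMDiff.mdifferentiable hf (by simp)) p

theorem DiffFn.add (hf : DiffFn (k := k) f p) (hg : DiffFn (k := k) g p) :
    DiffFn (k := k) (fun q => f q + g q) p := MDifferentiableAt.add hf hg

theorem DiffFn.mul (hf : DiffFn (k := k) f p) (hg : DiffFn (k := k) g p) :
    DiffFn (k := k) (fun q => f q * g q) p := MDifferentiableAt.mul hf hg

theorem SmoothFn.add (hf : SmoothFn (k := k) f) (hg : SmoothFn (k := k) g) :
    SmoothFn (k := k) (fun q => f q + g q) := ContMDiff.add hf hg

theorem SmoothFn.sub (hf : SmoothFn (k := k) f) (hg : SmoothFn (k := k) g) :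
    SmoothFn (k := k) (fun q => f q - g q) := ContMDiff.sub hf hg

theorem SmoothFn.mul (hf : SmoothFn (k := k) f) (hg : SmoothFn (k := k) g) :
    SmoothFn (k := k) (fun q => f q * g q) := ContMDiff.mul hf hg

theorem SmoothFn.neg (hf : SmoothFn (k := k) f) :
    SmoothFn (k := k) (fun q => - f q) := ContMDiff.neg hf

theorem SmoothFn.const (c : ℝ) : SmoothFn (k := k) (fun _ : N => c) := contMDiff_const

theorem dirDeriv_fun_add (V : VF k N) (hf : DiffFn (k := k) f p) (hg : DiffFn (k := k) g p) :
    dirDeriv V (fun q => f q + g q) p = dirDeriv V f p + dirDeriv V g p := by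
  unfold dirDeriv; rw [mvfderiv_fun_add hf hg]; rfl

theorem dirDeriv_fun_sub (V : VF k N) (hf : DiffFn (k := k) f p) (hg : DiffFn (k := k) g p) :
    dirDeriv V (fun q => f q - g q) p = dirDeriv V f p - dirDeriv V g p := by
  unfold dirDeriv; rw [mvfderiv_fun_sub hf hg]; rfl

theorem dirDeriv_fun_mul (V : VF k N) (hf : DiffFn (k := k) f p) (hg : DiffFn (k := k) g p) :
    dirDeriv V (fun q => f q * g q) p = f p * dirDeriv V g p + g p * dirDeriv V f p := by
  unfold dirDeriv; rw [mvfderiv_fun_mul hf hg]; rfl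

theorem dirDeriv_fun_const (V : VF k N) (c : ℝ) : dirDeriv V (fun _ => c) p = 0 := by
  unfold dirDeriv; rw [mvfderiv_const]; rfl

theorem dirDeriv_const_mul (V : VF k N) (c : ℝ) (hf : DiffFn (k := k) f p) :
    dirDeriv V (fun q => c * f q) p = c * dirDeriv V f p := by
  rw [dirDeriv_fun_mul V ((SmoothFn.const c).diff p) hf, dirDeriv_fun_const]; ring

theorem dirDeriv_congr (V : VF k N) (h : f =ᶠ[nhds p] g) : dirDeriv V f p = dirDeriv V g p := by
  unfold dirDeriv mvfderiv
  rw [h.mfderiv_eq]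
  rfl

theorem dirDeriv_vf_add (V W : VF k N) : dirDeriv (V + W) f p = dirDeriv V f p + dirDeriv W f p :=
  map_add (mvfderiv (𝓡 k) f p) (V p) (W p)

theorem dirDeriv_vf_smul (h : N → ℝ) (V : VF k N) :
    dirDeriv (h • V) f p = h p * dirDeriv V f p :=
  map_smul (mvfderiv (𝓡 k) f p) (h p) (V p)

end FunctionRules

variable [IsManifold (𝓡 k) ∞ N]

section FieldRules

variable {X W V : VF k N} {f : N → ℝ} {p : N} {θ : OneForm k N} {B : TwoTensor k N}

theorem SmoothVF.diff (hX : SmoothVF X) (p : N) : DiffVF X p :=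
  (ContMDiff.mdifferentiable hX (by simp)) p

theorem SmoothVF.sub (hX : SmoothVF X) (hW : SmoothVF W) : SmoothVF (X - W) :=
  ContMDiff.sub_section hX hW

theorem SmoothVF.smul (hf : SmoothFn (k := k) f) (hX : SmoothVF X) : SmoothVF (f • X) :=
  ContMDiff.smul_section hf hX

theorem DiffVF.add (hX : DiffVF X p) (hW : DiffVF W p) : DiffVF (X + W) p :=
  mdifferentiableAt_add_section hX hW

theorem DiffVF.smul (hf : DiffFn (k := k) f p) (hX : DiffVF X p) : DiffVF (f • X) p :=
  MDifferentiableAt.smul_section hf hX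

theorem SmoothVF.bracket (hX : SmoothVF X) (hW : SmoothVF W) : SmoothVF (bracket X W) := by
  intro p
  have := ContMDiffAt.mlieBracket_vectorField (I := 𝓡 k) (m := ⊤) (n := ⊤)
    (hX p) (hW p) (by simp)
  exact this

theorem SmoothOneForm.apply (hθ : SmoothOneForm θ) (hX : SmoothVF X) :
    SmoothFn (k := k) (fun q => θ q (X q)) := by
  have := ContMDiff.clm_bundle_apply (E₂ := Trivial N ℝ) (b := fun q : N => q) hθ hX
  intro p
  exact ((contMDiffAt_section _).1 (this p))

theorem SmoothOneForm.apply_diff (hθ : SmoothOneForm θ) (hX : DiffVF X p) :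
    DiffFn (k := k) (fun q => θ q (X q)) p := by
  have := MDifferentiableAt.clm_bundle_apply (E₂ := Trivial N ℝ) (b := fun q : N => q)
    ((ContMDiff.mdifferentiable hθ (by simp)) p) hX
  exact ((mdifferentiableAt_section _ _).1 this)

theorem SmoothTwoTensor.apply (hB : SmoothTwoTensor B) (hX : SmoothVF X) (hW : SmoothVF W) :
    SmoothFn (k := k) (fun q => B q (X q) (W q)) := by
  have := ContMDiff.clm_bundle_apply₂ (E₃ := Trivial N ℝ) (b := fun q : N => q) hB hX hW
  intro p
  exact ((contMDiffAt_section _).1 (this p))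

theorem SmoothTwoTensor.apply_diff (hB : SmoothTwoTensor B) (hX : DiffVF X p) (hW : DiffVF W p) :
    DiffFn (k := k) (fun q => B q (X q) (W q)) p := by
  have := MDifferentiableAt.clm_bundle_apply₂ (E₃ := Trivial N ℝ) (b := fun q : N => q)
    ((ContMDiff.mdifferentiable hB (by simp)) p) hX hW
  exact ((mdifferentiableAt_section _ _).1 this)

theorem SmoothFn.dirDeriv (hf : SmoothFn (k := k) f) (hX : SmoothVF X) :
    SmoothFn (k := k) (dirDeriv X f) := by
  have h1 : ContMDiff (𝓡 k).tangent 𝓘(ℝ, ℝ).tangent ∞ (tangentMap (𝓡 k) 𝓘(ℝ, ℝ) f) :=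
    ContMDiff.contMDiff_tangentMap hf (by simp)
  exact (contMDiff_snd_tangentBundle_modelSpace ℝ 𝓘(ℝ, ℝ)).comp (h1.comp hX)

omit [IsManifold (𝓡 k) ∞ N] in
theorem bracket_swap (X W : VF k N) (p : N) : bracket X W p = - bracket W X p :=
  mlieBracket_swap_apply

theorem bracket_add_left (Z : VF k N) (hX : DiffVF X p) (hW : DiffVF W p) :
    bracket (X + W) Z p = bracket X Z p + bracket W Z p := mlieBracket_add_left hX hW

theorem bracket_add_right (Z : VF k N) (hX : DiffVF X p) (hW : DiffVF W p) :
    bracket Z (X + W) p = bracket Z X p + bracket Z W p := mlieBracket_add_right hX hW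

theorem bracket_smul_left (Z : VF k N) (hf : DiffFn (k := k) f p) (hX : DiffVF X p) :
    bracket (f • X) Z p = - dirDeriv Z f p • X p + f p • bracket X Z p :=
  mlieBracket_smul_left hf hX

theorem bracket_smul_right (Z : VF k N) (hf : DiffFn (k := k) f p) (hX : DiffVF X p) :
    bracket Z (f • X) p = dirDeriv Z f p • X p + f p • bracket Z X p :=
  mlieBracket_smul_right hf hX

theorem jacobi (hX : SmoothVF X) (hW : SmoothVF W) (hV : SmoothVF V) :
    bracket X (bracket W V) = bracket (bracket X W) V + bracket W (bracket X V) := by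
  have h2 : minSmoothness ℝ 2 ≤ ∞ := by
    rw [minSmoothness_of_isRCLikeNormedField]; exact WithTop.coe_le_coe.2 (le_top : (2 : ℕ∞) ≤ ⊤)
  exact leibniz_identity_mlieBracket (hX.of_le h2) (hW.of_le h2) (hV.of_le h2)

end FieldRules

/-! ### Global extensions of local data, and smoothness tests -/

section Extension

variable [T2Space N]

/-- Global smooth fields that agree with the constant-coefficient extension near a point. -/
theorem exists_smooth_eventuallyEq_extend (p : N) (v : TangentSpace (𝓡 k) p) :
    ∃ Z : VF k N, SmoothVF Z ∧
      Z =ᶠ[nhds p] FiberBundle.extend (E k) (E := fun q : N => TangentSpace (𝓡 k) q) v := by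
  obtain ⟨s, hs, hsm⟩ := FiberBundle.exists_contMDiffOn_extend (k := ∞) (𝓡 k) (E k)
    (V := fun q : N => TangentSpace (𝓡 k) q) v
  obtain ⟨ψ, -, hψ⟩ := (SmoothBumpFunction.nhds_basis_tsupport (I := 𝓡 k) p).mem_iff.1
    (interior_mem_nhds.2 hs)
  refine ⟨(ψ : N → ℝ) • FiberBundle.extend (E k) (E := fun q : N => TangentSpace (𝓡 k) q) v, ?_, ?_⟩
  · exact ContMDiffOn.smul_section_of_tsupport ψ.contMDiff.contMDiffOn isOpen_interior hψ
      (hsm.mono interior_subset)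
  · filter_upwards [ψ.eventuallyEq_one] with q hq
    rw [Pi.smul_apply', hq]
    exact one_smul ℝ _

/-- Lets an identity between tangent vectors at a point be tested on smooth global fields. -/
theorem exists_smooth_apply_eq (p : N) (v : TangentSpace (𝓡 k) p) :
    ∃ Z : VF k N, SmoothVF Z ∧ Z p = v := by
  obtain ⟨Z, hZ, h⟩ := exists_smooth_eventuallyEq_extend p v
  exact ⟨Z, hZ, by rw [h.eq_of_nhds]; simp⟩

/-- The commutator identity `[U, V](f) = U(V(f)) - V(U(f))`. -/
theorem dirDeriv_bracket {U V : VF k N} {f : N → ℝ} (hU : SmoothVF U) (hV : SmoothVF V)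
    (hf : SmoothFn (k := k) f) (p : N) :
    dirDeriv (bracket U V) f p = dirDeriv U (dirDeriv V f) p - dirDeriv V (dirDeriv U f) p := by
  -- The Jacobi identity for `U`, `V`, `f • W`, minus `f` times the one for `U`, `V`, `W`, leaves
  -- exactly the commutator identity multiplied by `W`. This needs a `W` with `W p ≠ 0`; if the
  -- tangent space is trivial, all terms vanish.
  by_cases hk : ∃ w : TangentSpace (𝓡 k) p, w ≠ 0
  · obtain ⟨w, hw⟩ := hk
    obtain ⟨W, hW, rfl⟩ := exists_smooth_apply_eq p w
    have e : ∀ {A : VF k N} {h : N → ℝ}, SmoothVF A → SmoothFn (k := k) h → ∀ C : VF k N,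
        bracket C (h • A) = dirDeriv C h • A + h • bracket C A := by
      intro A h hA hh C; funext q; exact bracket_smul_right C (hh.diff q) (hA.diff q)
    have hUf := hf.dirDeriv hU
    have hVf := hf.dirDeriv hV
    have hUW := hU.bracket hW
    have hVW := hV.bracket hW
    have J := congrFun (jacobi hU hV (hW.smul hf)) p
    have J0 := congrFun (jacobi hU hV hW) p
    rw [e hW hf V, e hW hf U, e hW hf (bracket U V)] at J
    rw [Pi.add_apply] at J
    rw [bracket_add_right U ((hW.smul hVf).diff p) ((hVW.smul hf).diff p),
      bracket_smul_right U (hVf.diff p) (hW.diff p),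
      bracket_smul_right U (hf.diff p) (hVW.diff p),
      bracket_add_right V ((hW.smul hUf).diff p) ((hUW.smul hf).diff p),
      bracket_smul_right V (hUf.diff p) (hW.diff p),
      bracket_smul_right V (hf.diff p) (hUW.diff p), J0] at J
    simp only [Pi.add_apply, Pi.smul_apply'] at J
    have : (dirDeriv (bracket U V) f p - (dirDeriv U (dirDeriv V f) p
        - dirDeriv V (dirDeriv U f) p)) • W p = 0 := by
      linear_combination (norm := module) -J
    exact sub_eq_zero.1 ((smul_eq_zero.1 this).resolve_right hw)
  · push Not at hk
    simp [dirDeriv, hk (U p), hk (V p), hk (bracket U V p)]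

/-- A vector field is smooth if its contractions with a nondegenerate smooth tensor are. -/
theorem smoothVF_of_contraction {B : TwoTensor k N} {V : VF k N}
    (hB : ∀ X W : VF k N, SmoothVF X → SmoothVF W → SmoothFn (k := k) (fun q => B q (X q) (W q)))
    (hnd : ∀ p v, (∀ w, B p v w = 0) → v = 0)
    (hV : ∀ Z : VF k N, SmoothVF Z → SmoothFn (k := k) (fun q => B q (V q) (Z q))) :
    SmoothVF V := by
  intro p
  rw [contMDiffAt_section]
  set t := trivializationAt (E k) (TangentSpace (𝓡 k)) p with ht
  have hmem : t.baseSet ∈ nhds p :=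
    t.open_baseSet.mem_nhds (FiberBundle.mem_baseSet_trivializationAt' p)
  let e := EuclideanSpace.basisFun (Fin k) ℝ
  choose Z hZ hZe using fun i : Fin k => exists_smooth_eventuallyEq_extend p (t.symm p (e i))
  have hZe' : ∀ᶠ q in nhds p, ∀ i, Z i q = t.symm q (e i) := by
    rw [Filter.eventually_all]
    intro i
    filter_upwards [hZe i, hmem] with q hq hqm
    rw [hq]
    simp only [FiberBundle.extend]
    congr 1
    exact congrArg Prod.snd (t.apply_mk_symm (mem_of_mem_nhds hmem) (e i))
  -- `T q` is the Gram matrix of `B` in the local frame `Z`, and `F q` lists the contractions of `V`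
  -- with that frame. In the trivialisation `V` is the solution of `T q x = F q`, and operator
  -- inversion is smooth at an invertible map.
  let C : Fin k → Fin k → (E k →L[ℝ] E k) := fun i j => (EuclideanSpace.proj i).smulRight (e j)
  let T : N → (E k →L[ℝ] E k) := fun q => ∑ i, ∑ j, B q (Z i q) (Z j q) • C i j
  have hT : ContMDiffAt (𝓡 k) 𝓘(ℝ, E k →L[ℝ] E k) ∞ T p := by
    refine contMDiffAt_finsetSum fun i _ => contMDiffAt_finsetSum fun j _ => ?_
    exact ((hB _ _ (hZ i) (hZ j)) p).smul contMDiffAt_const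
  let F : N → E k := fun q => ∑ j, B q (V q) (Z j q) • e j
  have hF : ContMDiffAt (𝓡 k) 𝓘(ℝ, E k) ∞ F p :=
    contMDiffAt_finsetSum fun j _ => ((hV (Z j) (hZ j)) p).smul contMDiffAt_const
  have hTapp : ∀ᶠ q in nhds p, ∀ w : E k, T q w = ∑ j, B q (t.symm q w) (Z j q) • e j := by
    filter_upwards [hZe', hmem] with q hq hqm w
    have hw : t.symm q w = ∑ i, w i • Z i q := by
      have h1 : w = ∑ i, w i • e i := by
        simpa [e] using (e.sum_repr w).symm
      conv_lhs => rw [h1]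
      rw [← t.symmL_apply (R := ℝ) hqm, map_sum]
      exact Finset.sum_congr rfl fun i _ => by rw [map_smul, t.symmL_apply hqm, hq]
    simp only [T, C, hw, map_sum, map_smul]
    simp only [sum_apply, smul_apply,
      ContinuousLinearMap.smulRight_apply, Finset.sum_smul, smul_eq_mul]
    rw [Finset.sum_comm]
    refine Finset.sum_congr rfl fun j _ => Finset.sum_congr rfl fun i _ => ?_
    rw [smul_smul, mul_comm]
    rfl
  have hTinj : ∀ᶠ q in nhds p, Function.Injective (T q) := by
    filter_upwards [hTapp, hZe', hmem] with q hq hqZ hqm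
    refine (injective_iff_map_eq_zero (T q)).2 fun w hw => ?_
    rw [hq w] at hw
    have h0 : ∀ j, B q (t.symm q w) (Z j q) = 0 := by
      intro j
      have := congrArg (fun x : E k => x j) hw
      simpa [e, Finset.sum_apply, Pi.single_apply] using this
    have h1 : t.symm q w = 0 := by
      refine hnd q _ fun u => ?_
      have hu : u = t.symm q (t ⟨q, u⟩).2 := by
        rw [t.symm_apply_apply_mk hqm]
      have h2 : u = ∑ i, ((t ⟨q, u⟩).2 : E k) i • Z i q := by
        have h1 : (t ⟨q, u⟩).2 = ∑ i, ((t ⟨q, u⟩).2 : E k) i • e i := by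
          simpa [e] using (e.sum_repr (t ⟨q, u⟩).2).symm
        conv_lhs => rw [hu, h1]
        rw [← t.symmL_apply (R := ℝ) hqm, map_sum]
        exact Finset.sum_congr rfl fun i _ => by rw [map_smul, t.symmL_apply hqm, hqZ]
      rw [h2, map_sum]
      simp [h0]
    rw [← t.symmL_apply (R := ℝ) hqm] at h1
    rw [← t.continuousLinearMapAt_symmL (R := ℝ) hqm w, h1, map_zero]
  have hinv : ∀ q, Function.Injective (T q) → (T q).IsInvertible := fun q hq =>
    ⟨(LinearEquiv.ofInjectiveEndo (T q).toLinearMap hq).toContinuousLinearEquiv, by ext; rfl⟩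
  have hsol : (fun q => (t ⟨q, V q⟩).2) =ᶠ[nhds p] fun q => (T q).inverse (F q) := by
    filter_upwards [hTapp, hTinj, hmem] with q hq hinj hqm
    refine ((hinv q hinj).inverse_apply_eq.2 ?_).symm
    rw [hq, t.symm_apply_apply_mk hqm]
  refine ContMDiffAt.congr_of_eventuallyEq ?_ hsol
  obtain ⟨T₀, hT₀⟩ := hinv p hTinj.self_of_nhds
  have hI : ContDiffAt ℝ ∞ ContinuousLinearMap.inverse (T p) :=
    hT₀ ▸ contDiffAt_map_inverse T₀
  exact (hI.contMDiffAt.comp p hT).clm_apply hF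

end Extension

end Calculus

/-! ### Leibniz rules for contractions and Lie derivatives -/

section TensorRules

variable {k : ℕ} {N : Type*} [TopologicalSpace N] [ChartedSpace (E k) N] [IsManifold (𝓡 k) ∞ N]
  {X W V : VF k N} {f : N → ℝ} {p : N} {θ : OneForm k N} {B : TwoTensor k N}

theorem dirDeriv_oneForm_add (hθ : SmoothOneForm θ) (V : VF k N) (hX : DiffVF X p)
    (hW : DiffVF W p) :
    dirDeriv V (fun q => θ q ((X + W) q)) p
      = dirDeriv V (fun q => θ q (X q)) p + dirDeriv V (fun q => θ q (W q)) p := by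
  rw [← dirDeriv_fun_add V (hθ.apply_diff hX) (hθ.apply_diff hW)]
  congr 1; funext q; exact map_add (θ q) _ _

theorem dirDeriv_oneForm_smul (hθ : SmoothOneForm θ) (V : VF k N) (hf : DiffFn (k := k) f p)
    (hX : DiffVF X p) :
    dirDeriv V (fun q => θ q ((f • X) q)) p
      = f p * dirDeriv V (fun q => θ q (X q)) p + θ p (X p) * dirDeriv V f p := by
  rw [← dirDeriv_fun_mul V hf (hθ.apply_diff hX)]
  congr 1; funext q; exact map_smul (θ q) _ _

theorem dirDeriv_tensor_add_left (hB : SmoothTwoTensor B) (V : VF k N) {Z : VF k N}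
    (hX : DiffVF X p) (hW : DiffVF W p) (hZ : DiffVF Z p) :
    dirDeriv V (fun q => B q ((X + W) q) (Z q)) p
      = dirDeriv V (fun q => B q (X q) (Z q)) p + dirDeriv V (fun q => B q (W q) (Z q)) p := by
  rw [← dirDeriv_fun_add V (hB.apply_diff hX hZ) (hB.apply_diff hW hZ)]
  congr 1; funext q
  rw [Pi.add_apply, map_add]; rfl

theorem dirDeriv_tensor_add_right (hB : SmoothTwoTensor B) (V : VF k N) {Z : VF k N}
    (hX : DiffVF X p) (hW : DiffVF W p) (hZ : DiffVF Z p) :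
    dirDeriv V (fun q => B q (Z q) ((X + W) q)) p
      = dirDeriv V (fun q => B q (Z q) (X q)) p + dirDeriv V (fun q => B q (Z q) (W q)) p := by
  rw [← dirDeriv_fun_add V (hB.apply_diff hZ hX) (hB.apply_diff hZ hW)]
  congr 1; funext q; exact map_add (B q (Z q)) _ _

theorem dirDeriv_tensor_smul_left (hB : SmoothTwoTensor B) (V : VF k N) {Z : VF k N}
    (hf : DiffFn (k := k) f p) (hX : DiffVF X p) (hZ : DiffVF Z p) :
    dirDeriv V (fun q => B q ((f • X) q) (Z q)) p
      = f p * dirDeriv V (fun q => B q (X q) (Z q)) p + B p (X p) (Z p) * dirDeriv V f p := by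
  rw [← dirDeriv_fun_mul V hf (hB.apply_diff hX hZ)]
  congr 1; funext q
  rw [Pi.smul_apply', map_smul]; rfl

theorem dirDeriv_tensor_smul_right (hB : SmoothTwoTensor B) (V : VF k N) {Z : VF k N}
    (hf : DiffFn (k := k) f p) (hX : DiffVF X p) (hZ : DiffVF Z p) :
    dirDeriv V (fun q => B q (Z q) ((f • X) q)) p
      = f p * dirDeriv V (fun q => B q (Z q) (X q)) p + B p (Z p) (X p) * dirDeriv V f p := by
  rw [← dirDeriv_fun_mul V hf (hB.apply_diff hZ hX)]
  congr 1; funext q; exact map_smul (B q (Z q)) _ _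

theorem lieTwoTensor_smul (hf : DiffFn (k := k) f p) (hV : DiffVF V p)
    (B : TwoTensor k N) (X W : VF k N) :
    lieTwoTensor (f • V) B X W p = f p * lieTwoTensor V B X W p
      + dirDeriv X f p * B p (V p) (W p) + dirDeriv W f p * B p (X p) (V p) := by
  unfold lieTwoTensor
  rw [dirDeriv_vf_smul, bracket_smul_left X hf hV, bracket_smul_left W hf hV]
  simp only [map_add, map_smul, add_apply, smul_apply, smul_eq_mul]
  ring

theorem lieOneForm_smul (hf : DiffFn (k := k) f p) (hV : DiffVF V p)
    (θ : OneForm k N) (X : VF k N) :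
    lieOneForm (f • V) θ X p = f p * lieOneForm V θ X p + dirDeriv X f p * θ p (V p) := by
  unfold lieOneForm
  rw [dirDeriv_vf_smul, bracket_smul_left X hf hV]
  simp only [map_add, map_smul, smul_eq_mul]
  ring

end TensorRules

/-! ### Pointwise algebra of null hypersurface data -/

namespace NullData

variable {m : ℕ} {N : Type*} [TopologicalSpace N] [ChartedSpace (E m) N] [IsManifold (𝓡 m) ∞ N]
  (D : NullData m N)

instance finiteDimensional_tangentSpace (p : N) : FiniteDimensional ℝ (TangentSpace (𝓡 m) p) :=
  inferInstanceAs (FiniteDimensional ℝ (E m))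

/-- Under these conditions `(v, 0)` is orthogonal to everything for the nondegenerate form `𝒜`. -/
theorem eq_zero_of_rad (p : N) (v : TangentSpace (𝓡 m) p) (hv : ∀ w, D.γ p v w = 0)
    (hl : D.ell p v = 0) : v = 0 := by
  have := (D.nondeg p).1 (v, 0) (fun y => by simp [ambientForm, hv, hl])
  exact congrArg Prod.fst this

theorem n_spec (p : N) : (∀ w, D.γ p (D.n p) w = 0) ∧ D.ell p (D.n p) = 1 := by
  set x := ((ambientForm (D.γ p) (D.ell p) (D.ell2 p)).toDual (D.nondeg p)).symm
    (LinearMap.snd ℝ (TangentSpace (𝓡 m) p) ℝ) with hx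
  have hn : D.n p = x.1 := rfl
  have key : ∀ y : TangentSpace (𝓡 m) p × ℝ,
      D.γ p x.1 y.1 + x.2 * D.ell p y.1 + y.2 * D.ell p x.1 + x.2 * y.2 * D.ell2 p = y.2 := by
    intro y
    have := LinearMap.BilinForm.apply_toDual_symm_apply (hB := D.nondeg p)
      (LinearMap.snd ℝ (TangentSpace (𝓡 m) p) ℝ) y
    exact this
  obtain ⟨e, he, he0⟩ : ∃ e : TangentSpace (𝓡 m) p, (∀ w, D.γ p e w = 0) ∧ e ≠ 0 := by
    have h1 := D.γ_rad p
    obtain ⟨⟨e, he⟩, he0, -⟩ := finrank_eq_one_iff'.1 h1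
    refine ⟨e, fun w => ?_, fun h => he0 (Subtype.ext h)⟩
    have : D.γ p e = 0 := he
    rw [this]; rfl
  have hle : D.ell p e ≠ 0 := fun h => he0 (D.eq_zero_of_rad p e he h)
  -- Testing the dual vector `x` on `(e, 0)`, with `e` spanning the radical, leaves only `x.2 * ℓ(e)
  -- = 0`, and `ℓ(e) ≠ 0`. This is where the degeneracy of `γ` is used.
  have ha : x.2 = 0 := by
    have := key (e, 0)
    rw [D.γ_symm] at this
    simpa [he, hle] using this
  rw [hn]
  refine ⟨fun w => ?_, ?_⟩
  · simpa [ha] using key (w, 0)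
  · simpa [ha] using key (0, 1)

theorem γ_n_left (p : N) (w : TangentSpace (𝓡 m) p) : D.γ p (D.n p) w = 0 := (D.n_spec p).1 w

theorem γ_n_right (p : N) (w : TangentSpace (𝓡 m) p) : D.γ p w (D.n p) = 0 := by
  rw [D.γ_symm, D.γ_n_left]

theorem ell_n (p : N) : D.ell p (D.n p) = 1 := (D.n_spec p).2

theorem n_ne_zero (p : N) : D.n p ≠ 0 := fun h => by simpa [h] using D.ell_n p

theorem eq_smul_n_of_rad {p : N} {v : TangentSpace (𝓡 m) p} (hv : ∀ w, D.γ p v w = 0) :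
    v = D.ell p v • D.n p := by
  refine sub_eq_zero.1 (D.eq_zero_of_rad p _ (fun w => ?_) ?_)
  · simp [hv, γ_n_left]
  · simp [ell_n]

/-- The Riemannian metric `γ + ℓ ⊗ ℓ`. -/
def metric : TwoTensor m N := fun p => D.γ p + (D.ell p).smulRight (D.ell p)

theorem metric_apply (p : N) (v w : TangentSpace (𝓡 m) p) :
    D.metric p v w = D.γ p v w + D.ell p v * D.ell p w := rfl

/-- Testing on `n` isolates `ℓ(v)`, because `γ(v, n) = 0` and `ℓ(n) = 1`; what remains is the
radical condition. -/
theorem metric_nondegenerate (p : N) (v : TangentSpace (𝓡 m) p)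
    (hv : ∀ w, D.metric p v w = 0) : v = 0 := by
  have hl : D.ell p v = 0 := by
    simpa [metric_apply, γ_n_right, ell_n] using hv (D.n p)
  exact D.eq_zero_of_rad p v (fun w => by simpa [metric_apply, hl] using hv w) hl

/-- Tangent vectors are separated by `γ` and `ℓ`. -/
theorem ext_γ_ell {p : N} {v w : TangentSpace (𝓡 m) p} (hγ : ∀ z, D.γ p v z = D.γ p w z)
    (hl : D.ell p v = D.ell p w) : v = w :=
  sub_eq_zero.1 (D.eq_zero_of_rad p _ (fun z => by simp [hγ]) (by simp [hl]))

/-! ### Smoothness of the derived fields -/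

section Smoothness

variable {D} {X W : VF m N}

theorem γ_smoothFn (hX : SmoothVF X) (hW : SmoothVF W) :
    SmoothFn (k := m) (fun q => D.γ q (X q) (W q)) := D.γ_smooth.apply hX hW

theorem ell_smoothFn (hX : SmoothVF X) : SmoothFn (k := m) (fun q => D.ell q (X q)) :=
  D.ell_smooth.apply hX

theorem Y_smoothFn (hX : SmoothVF X) (hW : SmoothVF W) :
    SmoothFn (k := m) (fun q => D.Y q (X q) (W q)) := D.Y_smooth.apply hX hW

variable [T2Space N]

/-- A vector field is smooth if its contractions with `γ` and `ℓ` are. -/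
theorem smoothVF_of_γ_ell {V : VF m N}
    (hγ : ∀ Z : VF m N, SmoothVF Z → SmoothFn (k := m) (fun q => D.γ q (V q) (Z q)))
    (hl : SmoothFn (k := m) (fun q => D.ell q (V q))) : SmoothVF V :=
  smoothVF_of_contraction (B := D.metric)
    (fun _ _ hX hW => (γ_smoothFn hX hW).add ((ell_smoothFn hX).mul (ell_smoothFn hW)))
    D.metric_nondegenerate (fun Z hZ => (hγ Z hZ).add (hl.mul (ell_smoothFn hZ)))

variable (D) in
-- The contractions of `n` with `γ` and `ℓ` are the constants `0` and `1`, so inverting `𝒜` smoothly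
-- can be avoided.
theorem n_smooth : SmoothVF D.n :=
  smoothVF_of_γ_ell (D := D)
    (fun Z _ => by simpa only [γ_n_left] using SmoothFn.const 0)
    (by simpa only [ell_n] using SmoothFn.const 1)

omit [T2Space N] in
theorem extD_smoothFn {θ : OneForm m N} (hθ : SmoothOneForm θ) (hX : SmoothVF X)
    (hW : SmoothVF W) : SmoothFn (k := m) (extD θ X W) :=
  (((hθ.apply hW).dirDeriv hX).sub ((hθ.apply hX).dirDeriv hW)).sub (hθ.apply (hX.bracket hW))

omit [T2Space N] in
theorem lieTwoTensor_smoothFn {V : VF m N} {B : TwoTensor m N} (hB : SmoothTwoTensor B)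
    (hV : SmoothVF V) (hX : SmoothVF X) (hW : SmoothVF W) :
    SmoothFn (k := m) (lieTwoTensor V B X W) :=
  (((hB.apply hX hW).dirDeriv hV).sub (hB.apply (hV.bracket hX) hW)).sub
    (hB.apply hX (hV.bracket hW))

omit [T2Space N] in
theorem F_smoothFn (hX : SmoothVF X) (hW : SmoothVF W) : SmoothFn (k := m) (D.F X W) :=
  (SmoothFn.const _).mul (extD_smoothFn D.ell_smooth hX hW)

theorem s_smoothFn (hX : SmoothVF X) : SmoothFn (k := m) (D.s X) := F_smoothFn D.n_smooth hX

theorem r_smoothFn (hX : SmoothVF X) : SmoothFn (k := m) (D.r X) := Y_smoothFn D.n_smooth hX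

theorem U_smoothFn (hX : SmoothVF X) (hW : SmoothVF W) : SmoothFn (k := m) (D.U X W) :=
  (SmoothFn.const _).mul (lieTwoTensor_smoothFn D.γ_smooth D.n_smooth hX hW)

end Smoothness

theorem U_symm (X W : VF m N) (p : N) : D.U X W p = D.U W X p := by
  unfold U lieTwoTensor
  rw [D.γ_symm p (bracket D.n X p), D.γ_symm p (X p),
    show (fun q => D.γ q (X q) (W q)) = fun q => D.γ q (W q) (X q) from
      funext fun q => D.γ_symm q _ _]
  ring

theorem s_n (p : N) : D.s D.n p = 0 := by
  have : bracket D.n D.n p = 0 := congrFun (mlieBracket_self (I := 𝓡 m) (V := D.n)) p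
  simp [s, F, extD, this]

theorem lieOneForm_n_ell (X : VF m N) (p : N) : lieOneForm D.n D.ell X p = 2 * D.s X p := by
  simp [s, F, extD, ell_n, dirDeriv_fun_const, lieOneForm]

/-! ### Vector fields in the radical -/

section Radical

variable {D} {η : VF m N}

theorem alpha_smoothFn (hη : SmoothVF η) : SmoothFn (k := m) (D.alpha η) := ell_smoothFn hη

theorem eq_alpha_smul_n (hr : ∀ p, η p ∈ D.rad p) : η = D.alpha η • D.n :=
  funext fun p => D.eq_smul_n_of_rad (hr p)

theorem alpha_ne_zero (hr : ∀ p, η p ∈ D.rad p) {p : N} : D.alpha η p ≠ 0 ↔ η p ≠ 0 := by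
  conv_rhs => rw [eq_alpha_smul_n hr]
  simp [D.n_ne_zero p]

/-- Write `η = α n`; the terms containing derivatives of `α` are multiplied by contractions of `γ`
with `n`, which vanish. -/
theorem lieTwoTensor_γ_of_rad [T2Space N] (hη : SmoothVF η) (hr : ∀ p, η p ∈ D.rad p)
    (X W : VF m N) (p : N) :
    lieTwoTensor η D.γ X W p = D.alpha η p * (2 * D.U X W p) := by
  conv_lhs => rw [eq_alpha_smul_n hr]
  rw [lieTwoTensor_smul ((alpha_smoothFn hη).diff p) (D.n_smooth.diff p)]
  simp [γ_n_left, γ_n_right, U]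

/-- Since `£_η γ = 2α U`, the tensor `U` vanishes where `η ≠ 0`. That set is dense, and the zero set
of the continuous function `U(X, W)` is closed. -/
theorem IsAKH0.uVanishes [T2Space N] (h : D.IsAKH0 η) : D.UVanishes := by
  intro X W hX hW p
  have hdense : Dense {q | η q ≠ 0} := interior_eq_empty_iff_dense_compl.1 h.zeros
  have hcl : IsClosed {q | D.U X W q = 0} :=
    isClosed_eq (U_smoothFn hX hW).continuous continuous_const
  have hsub : {q | η q ≠ 0} ⊆ {q | D.U X W q = 0} := by
    intro q hq
    have h1 := h.lie_γ X W hX hW q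
    rw [lieTwoTensor_γ_of_rad h.smooth h.mem_rad] at h1
    have h2 := (alpha_ne_zero h.mem_rad (p := q)).2 hq
    simpa [h2] using h1
  exact hcl.closure_subset_iff.2 hsub (hdense p)

theorem isAKH0_of_uVanishes [T2Space N] (hη : SmoothVF η) (hU : D.UVanishes)
    (hr : ∀ p, η p ∈ D.rad p) (h0 : ∀ p, η p ≠ 0) : D.IsAKH0 η where
  smooth := hη
  mem_rad := hr
  zeros := by simp [h0]
  lie_γ X W hX hW p := by rw [lieTwoTensor_γ_of_rad hη hr, hU X W hX hW]; ring

end Radical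

end NullData

/-! ### Existence of the metric hypersurface connection -/

namespace NullData

variable {m : ℕ} {N : Type*} [TopologicalSpace N] [ChartedSpace (E m) N] [IsManifold (𝓡 m) ∞ N]
  (D : NullData m N)

/-- The Koszul expression of `γ`. -/
def koszul (X W Z : VF m N) (p : N) : ℝ :=
  (1 / 2) * (dirDeriv X (fun q => D.γ q (W q) (Z q)) p + dirDeriv W (fun q => D.γ q (X q) (Z q)) p
    - dirDeriv Z (fun q => D.γ q (X q) (W q)) p + D.γ p (bracket X W p) (Z p)
    - D.γ p (bracket X Z p) (W p) - D.γ p (bracket W Z p) (X p))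

/-- The symmetrised derivative of `ℓ`: `½ (X(ℓ(W)) + W(ℓ(X)) + ℓ([X, W]))`. -/
def koszulEll (X W : VF m N) (p : N) : ℝ :=
  (1 / 2) * (dirDeriv X (fun q => D.ell q (W q)) p + dirDeriv W (fun q => D.ell q (X q)) p
    + D.ell p (bracket X W p))

variable {D} {X X' W W' Z Z' : VF m N} {p : N} {f : N → ℝ}

/-- As in the Riemannian case, the derivatives of the coefficient cancel between the directional
derivatives and the brackets. Only symmetry of `γ` is needed for this, so degeneracy does no harm.
-/
theorem koszul_tensorial_left (hW : DiffVF W p) (hZ : DiffVF Z p) :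
    TensorialAt (𝓡 m) (E m) (fun X : VF m N => D.koszul X W Z p) p where
  smul {f X} hf hX := by
    unfold koszul
    rw [dirDeriv_vf_smul, dirDeriv_tensor_smul_left D.γ_smooth W hf hX hZ,
      dirDeriv_tensor_smul_left D.γ_smooth Z hf hX hW, bracket_smul_left W hf hX,
      bracket_smul_left Z hf hX]
    simp only [Pi.smul_apply', map_add, map_smul, add_apply, smul_apply, smul_eq_mul]
    ring
  add {X X'} hX hX' := by
    unfold koszul
    rw [dirDeriv_vf_add, dirDeriv_tensor_add_left D.γ_smooth W hX hX' hZ,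
      dirDeriv_tensor_add_left D.γ_smooth Z hX hX' hW, bracket_add_left W hX hX',
      bracket_add_left Z hX hX']
    simp only [Pi.add_apply, map_add, add_apply]
    ring

theorem koszul_tensorial_right (hW : DiffVF W p) (hX : DiffVF X p) :
    TensorialAt (𝓡 m) (E m) (fun Z : VF m N => D.koszul X W Z p) p where
  smul {f Z} hf hZ := by
    unfold koszul
    rw [dirDeriv_vf_smul, dirDeriv_tensor_smul_right D.γ_smooth X hf hZ hW,
      dirDeriv_tensor_smul_right D.γ_smooth W hf hZ hX, bracket_smul_right X hf hZ,
      bracket_smul_right W hf hZ]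
    simp only [Pi.smul_apply', map_add, map_smul, add_apply, smul_apply, smul_eq_mul]
    rw [D.γ_symm p (Z p) (W p), D.γ_symm p (Z p) (X p)]
    ring
  add {Z Z'} hZ hZ' := by
    unfold koszul
    rw [dirDeriv_vf_add, dirDeriv_tensor_add_right D.γ_smooth X hZ hZ' hW,
      dirDeriv_tensor_add_right D.γ_smooth W hZ hZ' hX, bracket_add_right X hZ hZ',
      bracket_add_right W hZ hZ']
    simp only [Pi.add_apply, map_add, add_apply]
    ring

theorem koszul_smul (hf : DiffFn (k := m) f p) (hX : DiffVF X p) (hW : DiffVF W p)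
    (hZ : DiffVF Z p) :
    D.koszul X (f • W) Z p
      = f p * D.koszul X W Z p + dirDeriv X f p * D.γ p (W p) (Z p) := by
  unfold koszul
  rw [dirDeriv_vf_smul, dirDeriv_tensor_smul_left D.γ_smooth X hf hW hZ,
    dirDeriv_tensor_smul_right D.γ_smooth Z hf hW hX, bracket_smul_right X hf hW,
    bracket_smul_left Z hf hW]
  simp only [Pi.smul_apply', map_add, map_smul, add_apply, smul_apply, smul_eq_mul]
  rw [D.γ_symm p (W p) (X p)]
  ring

theorem koszul_add (hX : DiffVF X p) (hW : DiffVF W p) (hW' : DiffVF W' p) (hZ : DiffVF Z p) :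
    D.koszul X (W + W') Z p = D.koszul X W Z p + D.koszul X W' Z p := by
  unfold koszul
  rw [dirDeriv_vf_add, dirDeriv_tensor_add_left D.γ_smooth X hW hW' hZ,
    dirDeriv_tensor_add_right D.γ_smooth Z hW hW' hX, bracket_add_right X hW hW',
    bracket_add_left Z hW hW']
  simp only [Pi.add_apply, map_add, add_apply]
  ring

theorem koszulEll_tensorial :
    TensorialAt (𝓡 m) (E m) (fun X : VF m N => D.koszulEll X W p) p where
  smul {f X} hf hX := by
    unfold koszulEll
    rw [dirDeriv_vf_smul, dirDeriv_oneForm_smul D.ell_smooth W hf hX, bracket_smul_left W hf hX]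
    simp only [map_add, map_smul, smul_eq_mul]
    ring
  add {X X'} hX hX' := by
    unfold koszulEll
    rw [dirDeriv_vf_add, dirDeriv_oneForm_add D.ell_smooth W hX hX', bracket_add_left W hX hX']
    simp only [map_add]
    ring

theorem koszulEll_smul (hf : DiffFn (k := m) f p) (hW : DiffVF W p) :
    D.koszulEll X (f • W) p = f p * D.koszulEll X W p + dirDeriv X f p * D.ell p (W p) := by
  unfold koszulEll
  rw [dirDeriv_vf_smul, dirDeriv_oneForm_smul D.ell_smooth X hf hW, bracket_smul_right X hf hW]
  simp only [map_add, map_smul, smul_eq_mul]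
  ring

theorem koszulEll_add (hW : DiffVF W p) (hW' : DiffVF W' p) :
    D.koszulEll X (W + W') p = D.koszulEll X W p + D.koszulEll X W' p := by
  unfold koszulEll
  rw [dirDeriv_vf_add, dirDeriv_oneForm_add D.ell_smooth X hW hW', bracket_add_right X hW hW']
  simp only [map_add]
  ring

variable (D) in
-- Terms with `n` in a slot of `γ` vanish, leaving half of `-£_n γ`. This nonzero value is the
-- obstruction to solving the Koszul equation for a degenerate `γ`, and the source of the `U` terms
-- in the connection.
theorem koszul_n (X W : VF m N) (p : N) : D.koszul X W D.n p = - D.U X W p := by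
  unfold koszul U lieTwoTensor
  rw [bracket_swap X D.n, bracket_swap W D.n]
  simp only [γ_n_right, dirDeriv_fun_const, map_neg, neg_apply]
  rw [D.γ_symm p (bracket D.n W p)]
  ring

/-- `γ` is parallel for the Koszul expression. -/
theorem koszul_add_swap (X W Z : VF m N) (p : N) :
    D.koszul X W Z p + D.koszul X Z W p = dirDeriv X (fun q => D.γ q (W q) (Z q)) p := by
  unfold koszul
  rw [show (fun q => D.γ q (Z q) (W q)) = fun q => D.γ q (W q) (Z q) from
      funext fun q => D.γ_symm q _ _, bracket_swap Z W, map_neg, neg_apply]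
  ring

theorem koszul_sub_swap (X W Z : VF m N) (p : N) :
    D.koszul X W Z p - D.koszul W X Z p = D.γ p (bracket X W p) (Z p) := by
  unfold koszul
  rw [show (fun q => D.γ q (W q) (X q)) = fun q => D.γ q (X q) (W q) from
      funext fun q => D.γ_symm q _ _, bracket_swap W X, map_neg, neg_apply]
  ring

theorem koszulEll_sub_swap (X W : VF m N) (p : N) :
    D.koszulEll X W p - D.koszulEll W X p = D.ell p (bracket X W p) := by
  unfold koszulEll
  rw [bracket_swap W X, map_neg]
  ring

theorem koszulEll_eq (X W : VF m N) (p : N) :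
    D.koszulEll X W p = dirDeriv X (fun q => D.ell q (W q)) p - D.F X W p := by
  unfold koszulEll F extD
  ring

variable [T2Space N]

/-- For each field `W` differentiable at `p` there is a linear map `v ↦ ∇°_v W` with the
components prescribed by the Koszul formula. -/
theorem exists_conn_at (hW : DiffVF W p) :
    ∃ A : TangentSpace (𝓡 m) p →L[ℝ] TangentSpace (𝓡 m) p,
      (∀ X Z : VF m N, DiffVF X p → DiffVF Z p →
        D.γ p (A (X p)) (Z p) = D.koszul X W Z p - D.ell p (Z p) * D.koszul X W D.n p) ∧
      ∀ X : VF m N, DiffVF X p →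
        D.ell p (A (X p)) = D.koszulEll X W p - D.ell2 p * D.koszul X W D.n p := by
  let k₀ := TensorialAt.mkHom₂ (I := 𝓡 m) (F := E m) (F' := E m)
    (fun X Z : VF m N => D.koszul X W Z p) p
    (fun Z hZ => koszul_tensorial_left hW hZ) (fun X hX => koszul_tensorial_right hW hX)
  let l₀ := TensorialAt.mkHom (I := 𝓡 m) (F := E m) (fun X : VF m N => D.koszulEll X W p) p
    koszulEll_tensorial
  let u₀ := TensorialAt.mkHom (I := 𝓡 m) (F := E m) (fun X : VF m N => D.koszul X W D.n p) p
    (koszul_tensorial_left hW (D.n_smooth.diff p))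
  have hk₀ : ∀ X Z : VF m N, DiffVF X p → DiffVF Z p →
      k₀ (X p) (Z p) = D.koszul X W Z p := fun X Z hX hZ =>
    TensorialAt.mkHom₂_apply _ _ hX hZ
  have hl₀ : ∀ X : VF m N, DiffVF X p → l₀ (X p) = D.koszulEll X W p := fun X hX =>
    TensorialAt.mkHom_apply _ hX
  have hu₀ : ∀ X : VF m N, DiffVF X p → u₀ (X p) = D.koszul X W D.n p := fun X hX =>
    TensorialAt.mkHom_apply _ hX
  -- The two prescribed halves are `k₀ - ℓ ⊗ u₀` for `γ` and `l₀ - ℓ⁽²⁾ u₀` for `ℓ`. Their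
  -- combination, the value required of `γ + ℓ ⊗ ℓ`, carries the factor `1 + ℓ⁽²⁾`. Evaluating at
  -- `n` recovers the `ℓ`-half, because `k₀(v, n) = u₀(v)`.
  let Ω : TangentSpace (𝓡 m) p →L[ℝ] TangentSpace (𝓡 m) p →L[ℝ] ℝ :=
    k₀ + (l₀ - (1 + D.ell2 p) • u₀).smulRight (D.ell p)
  let b : LinearMap.BilinForm ℝ (TangentSpace (𝓡 m) p) :=
    (ContinuousLinearMap.coeLM ℝ).comp (D.metric p).toLinearMap
  have hb : b.Nondegenerate := by
    refine ⟨fun v hv => D.metric_nondegenerate p v hv, fun v hv =>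
      D.metric_nondegenerate p v fun w => ?_⟩
    have : D.metric p w v = 0 := hv w
    rwa [metric_apply, D.γ_symm, mul_comm, ← metric_apply] at this
  have : T2Space (TangentSpace (𝓡 m) p) := inferInstanceAs (T2Space (E m))
  let A := LinearMap.toContinuousLinearMap
    ((b.toDual hb).symm.toLinearMap.comp ((ContinuousLinearMap.coeLM ℝ).comp Ω.toLinearMap))
  have hA : ∀ v z, D.metric p (A v) z = Ω v z := fun v z =>
    LinearMap.BilinForm.apply_toDual_symm_apply (hB := hb) _ z
  have hΩ : ∀ v z, Ω v z = k₀ v z + (l₀ v - (1 + D.ell2 p) * u₀ v) * D.ell p z :=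
    fun v z => rfl
  refine ⟨A, fun X Z hX hZ => ?_, fun X hX => ?_⟩
  all_goals
    have hAl : D.ell p (A (X p)) = D.koszulEll X W p - D.ell2 p * D.koszul X W D.n p := by
      have := hA (X p) (D.n p)
      rw [metric_apply, γ_n_right, ell_n, hΩ, ell_n, hl₀ X hX, hu₀ X hX,
        hk₀ X D.n hX (D.n_smooth.diff p)] at this
      linarith
  · have := hA (X p) (Z p)
    rw [metric_apply, hΩ, hAl, hk₀ X Z hX hZ, hu₀ X hX, hl₀ X hX] at this
    linear_combination this
  · exact hAl

open Classical in
variable (D) in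
/-- A connection given by the Koszul formula. -/
def koszulConn (W : VF m N) (p : N) : TangentSpace (𝓡 m) p →L[ℝ] TangentSpace (𝓡 m) p :=
  -- The default value is harmless: the covariant derivative axioms concern only fields
  -- differentiable at the point.
  if h : DiffVF W p then (exists_conn_at (D := D) h).choose else 0

theorem γ_koszulConn (hW : DiffVF W p) (hX : DiffVF X p) (hZ : DiffVF Z p) :
    D.γ p (D.koszulConn W p (X p)) (Z p)
      = D.koszul X W Z p - D.ell p (Z p) * D.koszul X W D.n p := by
  rw [koszulConn, dif_pos hW]
  exact (exists_conn_at hW).choose_spec.1 X Z hX hZ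

theorem ell_koszulConn (hW : DiffVF W p) (hX : DiffVF X p) :
    D.ell p (D.koszulConn W p (X p)) = D.koszulEll X W p - D.ell2 p * D.koszul X W D.n p := by
  rw [koszulConn, dif_pos hW]
  exact (exists_conn_at hW).choose_spec.2 X hX

variable (D) in
-- Each axiom is checked after contraction with `γ` and `ℓ`. The `U` corrections drop out of the
-- torsion because `U` is symmetric, of the Leibniz rule because `γ(·, n) = 0`, and produce the
-- prescribed right-hand sides in `∇°γ` and `∇°ℓ`.
theorem isMetricConnection_koszulConn : D.IsMetricConnection D.koszulConn where
  isCov := by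
    have hn := fun p => D.n_smooth.diff p
    constructor
    · intro W W' p hW hW' _
      ext v
      obtain ⟨X, hX, rfl⟩ := exists_smooth_apply_eq p v
      have hX := hX.diff p
      rw [add_apply]
      refine D.ext_γ_ell (fun z => ?_) ?_
      · obtain ⟨Z, hZ, rfl⟩ := exists_smooth_apply_eq p z
        have hZ := hZ.diff p
        rw [map_add, add_apply, γ_koszulConn (DiffVF.add hW hW') hX hZ,
          γ_koszulConn hW hX hZ, γ_koszulConn hW' hX hZ,
          koszul_add hX hW hW' hZ, koszul_add hX hW hW' (hn p)]
        ring
      · rw [map_add, ell_koszulConn (DiffVF.add hW hW') hX, ell_koszulConn hW hX,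
          ell_koszulConn hW' hX, koszulEll_add hW hW', koszul_add hX hW hW' (hn p)]
        ring
    · intro W f p hW hf _
      ext v
      obtain ⟨X, hX, rfl⟩ := exists_smooth_apply_eq p v
      have hX := hX.diff p
      change D.koszulConn (f • W) p (X p) = f p • D.koszulConn W p (X p) + dirDeriv X f p • W p
      refine D.ext_γ_ell (fun z => ?_) ?_
      · obtain ⟨Z, hZ, rfl⟩ := exists_smooth_apply_eq p z
        have hZ := hZ.diff p
        rw [map_add, map_smul, map_smul, add_apply, smul_apply, smul_apply,
          γ_koszulConn (DiffVF.smul hf hW) hX hZ, γ_koszulConn hW hX hZ,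
          koszul_smul hf hX hW hZ, koszul_smul hf hX hW (hn p), γ_n_right]
        simp only [smul_eq_mul]
        ring
      · rw [map_add, map_smul, map_smul, ell_koszulConn (DiffVF.smul hf hW) hX,
          ell_koszulConn hW hX, koszulEll_smul hf hW, koszul_smul hf hX hW (hn p), γ_n_right]
        simp only [smul_eq_mul]
        ring
  torsionFree X W hX hW p := by
    have hX := hX.diff p
    have hW := hW.diff p
    refine D.ext_γ_ell (fun z => ?_) ?_
    · obtain ⟨Z, hZ, rfl⟩ := exists_smooth_apply_eq p z
      have hZ := hZ.diff p
      rw [map_sub, sub_apply, γ_koszulConn hW hX hZ, γ_koszulConn hX hW hZ,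
        ← koszul_sub_swap, koszul_n, koszul_n, U_symm]
      ring
    · rw [map_sub, ell_koszulConn hW hX, ell_koszulConn hX hW, ← koszulEll_sub_swap,
        koszul_n, koszul_n, U_symm]
      ring
  nabla_γ A B C hA hB hC p := by
    rw [D.γ_symm p (B p), γ_koszulConn (hB.diff p) (hA.diff p) (hC.diff p),
      γ_koszulConn (hC.diff p) (hA.diff p) (hB.diff p), koszul_n, koszul_n, ← koszul_add_swap]
    ring
  nabla_ell A B hA hB p := by
    rw [ell_koszulConn (hB.diff p) (hA.diff p), koszulEll_eq, koszul_n]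
    ring

variable (D) in
/-- The metric hypersurface connection exists. -/
theorem isMetricConnection_conn : D.IsMetricConnection D.conn :=
  Classical.epsilon_spec ⟨D.koszulConn, D.isMetricConnection_koszulConn⟩

/-! ### Consequences of the defining properties of the connection -/

variable (D) in
theorem nab_sub_swap (hX : SmoothVF X) (hW : SmoothVF W) (p : N) :
    D.nab X W p - D.nab W X p = bracket X W p :=
  D.isMetricConnection_conn.torsionFree X W hX hW p

/-- The uniqueness half of Koszul's argument: combine the `∇°γ` equation for three permutations of
the fields and remove the differences by vanishing torsion. Only the axioms are used, since `conn`
is an arbitrary choice among their solutions. -/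
theorem γ_nab (hX : SmoothVF X) (hW : SmoothVF W) (hZ : SmoothVF Z) (p : N) :
    D.γ p (D.nab X W p) (Z p) = D.koszul X W Z p + D.ell p (Z p) * D.U X W p := by
  have hC := D.isMetricConnection_conn
  have e : ∀ {A B : VF m N}, SmoothVF A → SmoothVF B →
      bracket A B p = D.nab A B p - D.nab B A p := fun hA hB => (D.nab_sub_swap hA hB p).symm
  have h1 := hC.nabla_γ X W Z hX hW hZ p
  have h2 := hC.nabla_γ W X Z hW hX hZ p
  have h3 := hC.nabla_γ Z X W hZ hX hW p
  change _ - D.γ p (D.nab X W p) (Z p) - D.γ p (W p) (D.nab X Z p) = _ at h1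
  change _ - D.γ p (D.nab W X p) (Z p) - D.γ p (X p) (D.nab W Z p) = _ at h2
  change _ - D.γ p (D.nab Z X p) (W p) - D.γ p (X p) (D.nab Z W p) = _ at h3
  unfold koszul
  rw [e hX hW, e hX hZ, e hW hZ]
  simp only [map_sub, sub_apply]
  rw [D.γ_symm p (W p)] at h1
  rw [D.γ_symm p (X p)] at h2
  rw [D.γ_symm p (X p)] at h3
  rw [D.U_symm Z X, D.U_symm Z W] at h3
  rw [D.U_symm W X] at h2
  linear_combination (-1 / 2) * h1 - (1 / 2) * h2 + (1 / 2) * h3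

theorem ell_nab (hX : SmoothVF X) (hW : SmoothVF W) (p : N) :
    D.ell p (D.nab X W p) = D.koszulEll X W p + D.ell2 p * D.U X W p := by
  have h := D.isMetricConnection_conn.nabla_ell X W hX hW p
  change _ - D.ell p (D.nab X W p) = _ at h
  rw [koszulEll_eq]
  linear_combination -h

omit [T2Space N] in
theorem koszul_smoothFn (hX : SmoothVF X) (hW : SmoothVF W) (hZ : SmoothVF Z) :
    SmoothFn (k := m) (D.koszul X W Z) :=
  (SmoothFn.const _).mul ((((((γ_smoothFn hW hZ).dirDeriv hX).add
    ((γ_smoothFn hX hZ).dirDeriv hW)).sub ((γ_smoothFn hX hW).dirDeriv hZ)).add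
    (γ_smoothFn (hX.bracket hW) hZ)).sub (γ_smoothFn (hX.bracket hZ) hW) |>.sub
    (γ_smoothFn (hW.bracket hZ) hX))

omit [T2Space N] in
theorem koszulEll_smoothFn (hX : SmoothVF X) (hW : SmoothVF W) :
    SmoothFn (k := m) (D.koszulEll X W) :=
  (SmoothFn.const _).mul ((((ell_smoothFn hW).dirDeriv hX).add
    ((ell_smoothFn hX).dirDeriv hW)).add (ell_smoothFn (hX.bracket hW)))

theorem nab_smooth (hX : SmoothVF X) (hW : SmoothVF W) : SmoothVF (D.nab X W) := by
  refine smoothVF_of_γ_ell (D := D) (fun Z hZ => ?_) ?_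
  · rw [show (fun q => D.γ q (D.nab X W q) (Z q)) = _ from funext fun q => γ_nab hX hW hZ q]
    exact (koszul_smoothFn hX hW hZ).add ((ell_smoothFn hZ).mul (U_smoothFn hX hW))
  · rw [show (fun q => D.ell q (D.nab X W q)) = _ from funext fun q => ell_nab hX hW q]
    exact (koszulEll_smoothFn hX hW).add (SmoothFn.mul D.ell2_smooth (U_smoothFn hX hW))

theorem nabBar_smooth (hX : SmoothVF X) (hW : SmoothVF W) : SmoothVF (D.nabBar X W) :=
  (nab_smooth hX hW).sub (SmoothVF.smul (Y_smoothFn hX hW) D.n_smooth)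

theorem nab_smul (hf : SmoothFn (k := m) f) (hW : SmoothVF W) (X : VF m N) (p : N) :
    D.nab X (f • W) p = f p • D.nab X W p + dirDeriv X f p • W p := by
  have := D.isMetricConnection_conn.isCov.leibniz (hW.diff p) (hf.diff p)
  exact congrArg (fun A : TangentSpace (𝓡 m) p →L[ℝ] TangentSpace (𝓡 m) p => A (X p)) this

end NullData

/-! ### The Lie derivative of the connection along a field in the radical -/

namespace NullData

variable {m : ℕ} {N : Type*} [TopologicalSpace N] [ChartedSpace (E m) N] [IsManifold (𝓡 m) ∞ N]
  {D : NullData m N} {X W Z η : VF m N} {p : N} {f : N → ℝ}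

theorem two_mul_s (X : VF m N) (p : N) :
    2 * D.s X p = dirDeriv D.n (fun q => D.ell q (X q)) p - D.ell p (bracket D.n X p) :=
  (D.lieOneForm_n_ell X p).symm

variable [T2Space N]

omit [T2Space N] in
-- Needed because `s` takes a field as argument, so that its additivity is not built into a linear
-- map.
theorem s_add (hX : SmoothVF X) (hW : SmoothVF W) (p : N) :
    D.s (X + W) p = D.s X p + D.s W p := by
  have h := two_mul_s (D := D) (X + W) p
  rw [dirDeriv_oneForm_add D.ell_smooth _ (hX.diff p) (hW.diff p),
    bracket_add_right _ (hX.diff p) (hW.diff p), map_add] at h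
  linear_combination (1 / 2) * h - (1 / 2) * two_mul_s (D := D) X p
    - (1 / 2) * two_mul_s (D := D) W p

theorem nab_eq_add (hX : SmoothVF X) (hW : SmoothVF W) :
    D.nab X W = bracket X W + D.nab W X :=
  funext fun p => sub_eq_iff_eq_add.1 (D.nab_sub_swap hX hW p)

theorem lieOneForm_ell_of_rad (hη : SmoothVF η) (hr : ∀ p, η p ∈ D.rad p) (X : VF m N) (p : N) :
    lieOneForm η D.ell X p = dirDeriv X (D.alpha η) p + 2 * D.alpha η p * D.s X p := by
  conv_lhs => rw [eq_alpha_smul_n hr]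
  rw [lieOneForm_smul ((alpha_smoothFn hη).diff p) (D.n_smooth.diff p), lieOneForm_n_ell, ell_n]
  ring

theorem bracket_n_of_rad (hη : SmoothVF η) (hr : ∀ p, η p ∈ D.rad p) (p : N) :
    bracket η D.n p = - dirDeriv D.n (D.alpha η) p • D.n p := by
  have : bracket D.n D.n p = 0 := congrFun (mlieBracket_self (I := 𝓡 m) (V := D.n)) p
  conv_lhs => rw [eq_alpha_smul_n hr]
  rw [bracket_smul_left _ ((alpha_smoothFn hη).diff p) (D.n_smooth.diff p), this, smul_zero,
    add_zero]

/-- The Lie derivative of a torsion-free connection is symmetric. -/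
theorem lieConnection_nab_symm (hη : SmoothVF η) (hX : SmoothVF X) (hW : SmoothVF W) (p : N) :
    lieConnection D.nab η X W p = lieConnection D.nab η W X p := by
  have J := congrFun (jacobi hη hX hW) p
  rw [Pi.add_apply] at J
  have h1 := D.nab_sub_swap hX (hη.bracket hW) p
  have h2 := D.nab_sub_swap hW (hη.bracket hX) p
  unfold lieConnection
  rw [nab_eq_add hX hW, bracket_add_right _ ((hX.bracket hW).diff p) ((nab_smooth hW hX).diff p),
    J, ← h1, bracket_swap (bracket η X) W, ← h2]
  abel

/-! ### The case of vanishing `U`: parallel degenerate metric -/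

section UVanishes

variable (hU : D.UVanishes)
include hU

theorem dirDeriv_γ (hX : SmoothVF X) (hW : SmoothVF W) (hZ : SmoothVF Z) (p : N) :
    dirDeriv X (fun q => D.γ q (W q) (Z q)) p
      = D.γ p (D.nab X W p) (Z p) + D.γ p (W p) (D.nab X Z p) := by
  have h := D.isMetricConnection_conn.nabla_γ X W Z hX hW hZ p
  rw [hU X Z hX hZ, hU X W hX hW] at h
  change _ - D.γ p (D.nab X W p) (Z p) - D.γ p (W p) (D.nab X Z p) = _ at h
  linear_combination h

theorem ell_nab_of_uVanishes (hX : SmoothVF X) (hW : SmoothVF W) (p : N) :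
    D.ell p (D.nab X W p) = D.koszulEll X W p := by
  rw [ell_nab hX hW, hU X W hX hW]; ring

/-- Differentiating `γ(n, ·) = 0` with `γ` parallel puts `∇°_X n` in the radical. Its coefficient is
read off with `ℓ`, using `£_n ℓ = 2s`. -/
theorem nab_n (hX : SmoothVF X) (p : N) : D.nab X D.n p = D.s X p • D.n p := by
  have h1 : ∀ z, D.γ p (D.nab X D.n p) z = 0 := by
    intro z
    obtain ⟨Z, hZ, rfl⟩ := exists_smooth_apply_eq p z
    have := dirDeriv_γ hU hX D.n_smooth hZ p
    simpa [γ_n_left, dirDeriv_fun_const] using this.symm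
  have h2 : D.ell p (D.nab X D.n p) = D.s X p := by
    rw [ell_nab_of_uVanishes hU hX D.n_smooth, koszulEll, bracket_swap X D.n]
    have := two_mul_s (D := D) X p
    simp only [ell_n, dirDeriv_fun_const, map_neg]
    linear_combination -(1 / 2) * this
  rw [D.eq_smul_n_of_rad h1, h2]

theorem dirDeriv_γ_of_rad (hη : SmoothVF η) (hr : ∀ p, η p ∈ D.rad p) (hX : SmoothVF X)
    (hW : SmoothVF W) (p : N) :
    dirDeriv η (fun q => D.γ q (X q) (W q)) p
      = D.γ p (bracket η X p) (W p) + D.γ p (X p) (bracket η W p) := by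
  have h := lieTwoTensor_γ_of_rad hη hr X W p
  rw [hU X W hX hW] at h
  unfold lieTwoTensor at h
  linear_combination h

/-- Apply `[η, X] = ηX - Xη` to `γ(W, Z)` and expand each derivative by invariance under `η` and
parallelism of `γ`. -/
theorem γ_lieConnection_swap (hη : SmoothVF η) (hr : ∀ p, η p ∈ D.rad p) (hX : SmoothVF X)
    (hW : SmoothVF W) (hZ : SmoothVF Z) (p : N) :
    D.γ p (lieConnection D.nab η X W p) (Z p) + D.γ p (lieConnection D.nab η X Z p) (W p) = 0 := by
  have c := dirDeriv_bracket hη hX (γ_smoothFn (D := D) hW hZ) p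
  have e1 : dirDeriv X (fun q => D.γ q (W q) (Z q))
      = fun q => D.γ q (D.nab X W q) (Z q) + D.γ q (W q) (D.nab X Z q) :=
    funext fun q => dirDeriv_γ hU hX hW hZ q
  have e2 : dirDeriv η (fun q => D.γ q (W q) (Z q))
      = fun q => D.γ q (bracket η W q) (Z q) + D.γ q (W q) (bracket η Z q) :=
    funext fun q => dirDeriv_γ_of_rad hU hη hr hW hZ q
  have nW := nab_smooth (D := D) hX hW
  have nZ := nab_smooth (D := D) hX hZ
  have bW := hη.bracket hW
  have bZ := hη.bracket hZ
  rw [e1, e2, dirDeriv_γ hU (hη.bracket hX) hW hZ,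
    dirDeriv_fun_add _ ((γ_smoothFn nW hZ).diff p) ((γ_smoothFn hW nZ).diff p),
    dirDeriv_fun_add _ ((γ_smoothFn bW hZ).diff p) ((γ_smoothFn hW bZ).diff p),
    dirDeriv_γ_of_rad hU hη hr nW hZ, dirDeriv_γ_of_rad hU hη hr hW nZ,
    dirDeriv_γ hU hX bW hZ, dirDeriv_γ hU hX hW bZ] at c
  unfold lieConnection
  simp only [map_sub, sub_apply]
  rw [D.γ_symm p (bracket η (D.nab X Z) p), D.γ_symm p (D.nab X (bracket η Z) p),
    D.γ_symm p (D.nab (bracket η X) Z p)]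
  linear_combination -c

/-- A trilinear expression symmetric in its first two arguments and antisymmetric in its last two is
zero: combine the three cyclic antisymmetry relations. -/
theorem γ_lieConnection_nab (hη : SmoothVF η) (hr : ∀ p, η p ∈ D.rad p) (hX : SmoothVF X)
    (hW : SmoothVF W) (p : N) (z : TangentSpace (𝓡 m) p) :
    D.γ p (lieConnection D.nab η X W p) z = 0 := by
  obtain ⟨Z, hZ, rfl⟩ := exists_smooth_apply_eq p z
  have s1 := γ_lieConnection_swap hU hη hr hX hW hZ p
  have s2 := γ_lieConnection_swap hU hη hr hW hZ hX p
  have s3 := γ_lieConnection_swap hU hη hr hZ hX hW p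
  rw [lieConnection_nab_symm hη hZ hX] at s3
  rw [lieConnection_nab_symm hη hW hX] at s2
  rw [lieConnection_nab_symm hη hZ hW] at s3
  linear_combination (1 / 2) * s1 + (1 / 2) * s2 - (1 / 2) * s3

/-- With `U = 0` the symmetric part of `∇°ℓ` vanishes, and so does its Lie derivative. Hence `ℓ(£_η
∇°)` equals the symmetrised `∇°(£_η ℓ)`, where `£_η ℓ = dα + 2α s`. In the computation, second
derivatives of `ℓ(W)` and `ℓ(X)` cancel by the commutator and Jacobi identities. -/
theorem ell_lieConnection_nab (hη : SmoothVF η) (hr : ∀ p, η p ∈ D.rad p) (hX : SmoothVF X)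
    (hW : SmoothVF W) (p : N) :
    D.ell p (lieConnection D.nab η X W p)
      = (dirDeriv X (dirDeriv W (D.alpha η)) p - dirDeriv (D.nab X W) (D.alpha η) p)
        + (dirDeriv X (D.alpha η) p * D.s W p + dirDeriv W (D.alpha η) p * D.s X p)
        + D.alpha η p * (D.nabS X W p + D.nabS W X p) := by
  have hα : SmoothFn (k := m) (D.alpha η) := alpha_smoothFn hη
  have bW := hη.bracket hW
  have bX := hη.bracket hX
  have bXW := hX.bracket hW
  have nXW := nab_smooth (D := D) hX hW
  have nWX := nab_smooth (D := D) hW hX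
  -- `ℓ([η, V])` in terms of the Lie derivative of `ℓ`
  have lie : ∀ (V : VF m N) (q : N), D.ell q (bracket η V q)
      = dirDeriv η (fun z => D.ell z (V z)) q
        - (dirDeriv V (D.alpha η) q + 2 * D.alpha η q * D.s V q) := by
    intro V q
    have := lieOneForm_ell_of_rad hη hr V q
    unfold lieOneForm at this
    linear_combination -this
  have dlie : ∀ A V : VF m N, SmoothVF A → SmoothVF V →
      dirDeriv A (fun q => D.ell q (bracket η V q)) p
        = dirDeriv A (dirDeriv η (fun z => D.ell z (V z))) p
          - (dirDeriv A (dirDeriv V (D.alpha η)) p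
            + 2 * (dirDeriv A (D.alpha η) p * D.s V p
              + D.alpha η p * dirDeriv A (D.s V) p)) := by
    intro A V hA hV
    have h1 := (ell_smoothFn (D := D) hV).dirDeriv hη
    have h2 := hα.dirDeriv hV
    have h3 := s_smoothFn (D := D) hV
    rw [funext (lie V), dirDeriv_fun_sub A (h1.diff p)
      ((h2.diff p).add ((((SmoothFn.const 2).mul hα).mul h3).diff p)),
      dirDeriv_fun_add A (h2.diff p) ((((SmoothFn.const 2).mul hα).mul h3).diff p),
      dirDeriv_fun_mul A (((SmoothFn.const 2).mul hα).diff p) (h3.diff p),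
      dirDeriv_const_mul A 2 (hα.diff p)]
    ring
  have ek : (fun q => D.ell q (D.nab X W q)) = D.koszulEll X W :=
    funext fun q => ell_nab_of_uVanishes hU hX hW q
  have fW := ell_smoothFn (D := D) hW
  have fX := ell_smoothFn (D := D) hX
  have fb := ell_smoothFn (D := D) bXW
  have dk : dirDeriv η (D.koszulEll X W) p
      = (1 / 2) * (dirDeriv η (dirDeriv X (fun q => D.ell q (W q))) p
        + dirDeriv η (dirDeriv W (fun q => D.ell q (X q))) p
        + dirDeriv η (fun q => D.ell q (bracket X W q)) p) := by
    unfold koszulEll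
    rw [dirDeriv_const_mul η _ ((((fW.dirDeriv hX).add (fX.dirDeriv hW)).add fb).diff p),
      dirDeriv_fun_add η (((fW.dirDeriv hX).add (fX.dirDeriv hW)).diff p) (fb.diff p),
      dirDeriv_fun_add η ((fW.dirDeriv hX).diff p) ((fX.dirDeriv hW).diff p)]
  have J := congrArg (D.ell p) (congrFun (jacobi hη hX hW) p)
  rw [Pi.add_apply, map_add, lie] at J
  have cW := dirDeriv_bracket hη hX fW p
  have cX := dirDeriv_bracket hη hW fX p
  have cα := dirDeriv_bracket hX hW hα p
  have sd : D.s (D.nab X W) p = D.s (bracket X W) p + D.s (D.nab W X) p := by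
    rw [nab_eq_add hX hW, s_add bXW nWX]
  have t1 := ell_nab_of_uVanishes hU hX bW p
  have t2 := ell_nab_of_uVanishes hU bX hW p
  unfold koszulEll at t1 t2
  rw [dlie X W hX hW] at t1
  rw [dlie W X hW hX] at t2
  unfold lieConnection nabS
  simp only [map_sub]
  rw [lie, ek, dk, t1, t2]
  linear_combination (1 / 2) * J - (1 / 2) * cW - (1 / 2) * cX + (1 / 2) * cα
    - D.alpha η p * sd

/-- The part from `∇°` is a multiple of `n`, given by the two preceding lemmas. The part from `Y ⊗
n` uses `[η, n] = -n(α) n`, the source of `+n(α) Y`, and the expansion of `£_{αn} Y`, whose `dα`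
terms contain `r`. -/
theorem sigmaBar_eq (hη : SmoothVF η) (hr : ∀ p, η p ∈ D.rad p) (hX : SmoothVF X)
    (hW : SmoothVF W) (p : N) :
    D.sigmaBar η X W p = D.akh1Expr (D.alpha η) X W p • D.n p := by
  have hS := D.eq_smul_n_of_rad (γ_lieConnection_nab hU hη hr hX hW p)
  rw [ell_lieConnection_nab hU hη hr hX hW] at hS
  have hY := Y_smoothFn (D := D) hX hW
  have hb : bracket η (D.nabBar X W) p
      = bracket η (D.nab X W) p - dirDeriv η (fun q => D.Y q (X q) (W q)) p • D.n p
        + (D.Y p (X p) (W p) * dirDeriv D.n (D.alpha η) p) • D.n p := by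
    have e : D.nabBar X W = D.nab X W + (fun q => - D.Y q (X q) (W q)) • D.n := by
      funext q
      change D.nab X W q - D.Y q (X q) (W q) • D.n q
        = D.nab X W q + (- D.Y q (X q) (W q)) • D.n q
      rw [neg_smul, sub_eq_add_neg]
    have e2 : dirDeriv η (fun q => - D.Y q (X q) (W q)) p
        = - dirDeriv η (fun q => D.Y q (X q) (W q)) p := by
      have := dirDeriv_const_mul (p := p) η (-1) (hY.diff p)
      simpa using this
    rw [e, bracket_add_right _ ((nab_smooth hX hW).diff p)
      ((SmoothVF.smul hY.neg D.n_smooth).diff p),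
      bracket_smul_right _ (hY.neg.diff p) (D.n_smooth.diff p), e2, bracket_n_of_rad hη hr]
    module
  have hL : lieTwoTensor η D.Y X W p = D.alpha η p * lieTwoTensor D.n D.Y X W p
      + dirDeriv X (D.alpha η) p * D.r W p + dirDeriv W (D.alpha η) p * D.r X p := by
    conv_lhs => rw [eq_alpha_smul_n hr]
    rw [lieTwoTensor_smul ((alpha_smoothFn hη).diff p) (D.n_smooth.diff p), D.Y_symm p (X p)]
    rfl
  unfold sigmaBar lieConnection
  rw [hb]
  have hS' : bracket η (D.nab X W) p
      = D.nab X (bracket η W) p + D.nab (bracket η X) W p + lieConnection D.nab η X W p := by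
    unfold lieConnection
    abel
  have hL' : dirDeriv η (fun q => D.Y q (X q) (W q)) p = D.Y p (bracket η X p) (W p)
      + D.Y p (X p) (bracket η W p) + lieTwoTensor η D.Y X W p := by
    unfold lieTwoTensor
    ring
  rw [hS', hL', hS, hL]
  unfold nabBar akh1Expr
  module

theorem sigmaBar_eq_zero_iff (hη : SmoothVF η) (hr : ∀ p, η p ∈ D.rad p) :
    (∀ X W : VF m N, SmoothVF X → SmoothVF W → ∀ p, D.sigmaBar η X W p = 0) ↔
      ∀ X W : VF m N, SmoothVF X → SmoothVF W → ∀ p, D.akh1Expr (D.alpha η) X W p = 0 := by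
  refine forall₂_congr fun X W => forall₂_congr fun hX hW => forall_congr' fun p => ?_
  rw [sigmaBar_eq hU hη hr hX hW, smul_eq_zero, or_iff_left (D.n_ne_zero p)]

/-- The connection induced by `∇̄` on the line bundle spanned by the radical. -/
theorem nabBar_of_rad (hη : SmoothVF η) (hr : ∀ p, η p ∈ D.rad p) (hX : SmoothVF X) (p : N) :
    D.nabBar X η p = (dirDeriv X (D.alpha η) p
      + D.alpha η p * (D.s X p - D.r X p)) • D.n p := by
  unfold nabBar
  conv_lhs => rw [eq_alpha_smul_n hr]
  rw [nab_smul (alpha_smoothFn hη) D.n_smooth, nab_n hU hX, Pi.smul_apply', map_smul,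
    D.Y_symm p (X p)]
  simp only [r, smul_eq_mul]
  module

end UVanishes

end NullData

/-! ### Components in the preferred charts -/

section Chart

variable {k : ℕ} {N : Type*} [TopologicalSpace N] [ChartedSpace (E k) N] {p : N}

theorem DiffFn.sum {ι : Type*} {f : ι → N → ℝ} (t : Finset ι)
    (hf : ∀ i ∈ t, DiffFn (k := k) (f i) p) : DiffFn (k := k) (fun q => ∑ i ∈ t, f i q) p := by
  classical
  induction t using Finset.induction_on with
  | empty => simpa using (SmoothFn.const 0).diff p
  | insert i t hi ih =>
    simp only [Finset.sum_insert hi]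
    exact (hf i (Finset.mem_insert_self i t)).add
      (ih fun j hj => hf j (Finset.mem_insert_of_mem hj))

theorem dirDeriv_fun_sum {ι : Type*} {f : ι → N → ℝ} (V : VF k N) (t : Finset ι)
    (hf : ∀ i ∈ t, DiffFn (k := k) (f i) p) :
    dirDeriv V (fun q => ∑ i ∈ t, f i q) p = ∑ i ∈ t, dirDeriv V (f i) p := by
  classical
  induction t using Finset.induction_on with
  | empty => simpa using dirDeriv_fun_const V 0
  | insert i t hi ih =>
    simp only [Finset.sum_insert hi]
    have h := fun j hj => hf j (Finset.mem_insert_of_mem hj)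
    rw [dirDeriv_fun_add V (hf i (Finset.mem_insert_self i t)) (DiffFn.sum t h), ih h]

/-- A smooth function on an open set agrees near each point with a globally smooth function. -/
theorem exists_smoothFn_eventuallyEq [IsManifold (𝓡 k) ∞ N] [T2Space N] {f : N → ℝ} {s : Set N}
    (hs : s ∈ nhds p) (hf : ContMDiffOn (𝓡 k) 𝓘(ℝ, ℝ) ∞ f s) :
    ∃ h : N → ℝ, SmoothFn (k := k) h ∧ h =ᶠ[nhds p] f := by
  obtain ⟨ψ, -, hψ⟩ := (SmoothBumpFunction.nhds_basis_tsupport (I := 𝓡 k) p).mem_iff.1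
    (interior_mem_nhds.2 hs)
  refine ⟨fun q => ψ q * f q, ?_, ?_⟩
  · refine contMDiff_of_tsupport fun q hq => ?_
    have hq' : q ∈ interior s := hψ (closure_mono (fun z hz => left_ne_zero_of_mul hz) hq)
    exact ψ.contMDiff.contMDiffAt.mul (hf.contMDiffAt (mem_interior_iff_mem_nhds.1 hq'))
  · filter_upwards [ψ.eventuallyEq_one] with q hq
    rw [hq]
    exact one_mul _

variable {M : Type*} [TopologicalSpace M] [ChartedSpace (E k) M] [IsManifold (𝓡 k) ∞ M] {y z : M}

omit [IsManifold (𝓡 k) ∞ M] in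
theorem baseSet_mem_nhds (y : M) : (chartAt (E k) y).source ∈ nhds y :=
  (chartAt (E k) y).open_source.mem_nhds (mem_chart_source _ y)

theorem coordComp_eq (hz : z ∈ (chartAt (E k) y).source) (μ : Fin k)
    (v : TangentSpace (𝓡 k) z) :
    coordComp y μ z v = (trivializationAt (E k) (TangentSpace (𝓡 k)) y).continuousLinearMapAt ℝ z v μ := by
  have hz' : z ∈ (trivializationAt (E k) (TangentSpace (𝓡 k)) y).baseSet := by simpa using hz
  exact (congrArg (fun x : E k => x μ)
    (Trivialization.continuousLinearMapAt_apply_of_mem (R := ℝ) _ hz' v)).symm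

theorem coordComp_smul (hz : z ∈ (chartAt (E k) y).source) (μ : Fin k) (c : ℝ)
    (v : TangentSpace (𝓡 k) z) :
    coordComp y μ z (c • v) = c * coordComp y μ z v := by
  simp only [coordComp_eq hz, map_smul]
  rfl

theorem coordField_eq (hz : z ∈ (chartAt (E k) y).source) (μ : Fin k) :
    coordField y μ z = (trivializationAt (E k) (TangentSpace (𝓡 k)) y).symmL ℝ z
      (EuclideanSpace.single μ 1) :=
  (Trivialization.symmL_apply _ (by simpa using hz) _).symm

theorem sum_coordComp_smul_coordField (hz : z ∈ (chartAt (E k) y).source)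
    (v : TangentSpace (𝓡 k) z) : ∑ μ, coordComp y μ z v • coordField y μ z = v := by
  simp only [coordComp_eq hz, coordField_eq hz]
  set t := trivializationAt (E k) (TangentSpace (𝓡 k)) y
  have hz' : z ∈ t.baseSet := by simpa [t] using hz
  set x := t.continuousLinearMapAt ℝ z v with hx
  have e : ∑ μ, x μ • EuclideanSpace.single μ (1 : ℝ) = x := by
    simpa using (EuclideanSpace.basisFun (Fin k) ℝ).sum_repr x
  conv_rhs => rw [← t.symmL_continuousLinearMapAt (R := ℝ) hz' v, ← hx, ← e, map_sum]
  simp only [map_smul]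
  rfl

theorem coordComp_sum_smul_coordField (hz : z ∈ (chartAt (E k) y).source) (a : Fin k → ℝ)
    (ν : Fin k) : coordComp y ν z (∑ μ, a μ • coordField y μ z) = a ν := by
  simp only [coordComp_eq hz, coordField_eq hz]
  set t := trivializationAt (E k) (TangentSpace (𝓡 k)) y
  have hz' : z ∈ t.baseSet := by simpa [t] using hz
  have e := t.continuousLinearMapAt_symmL (R := ℝ) hz' (∑ μ, a μ • EuclideanSpace.single μ (1 : ℝ))
  simp only [map_sum, map_smul] at e ⊢
  rw [e]
  simp [Pi.single_apply]

theorem coordField_diff (y : M) (μ : Fin k) : DiffVF (coordField (k := k) y μ) y := by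
  rw [DiffVF, mdifferentiableAt_section]
  refine (mdifferentiableAt_const (c := EuclideanSpace.single μ (1 : ℝ))).congr_of_eventuallyEq ?_
  filter_upwards [baseSet_mem_nhds (k := k) y] with z hz
  exact congrArg Prod.snd (Trivialization.apply_mk_symm _ (by simpa using hz) _)

/-- Expresses components as derivatives of coordinate functions, so that vanishing torsion can be
deduced from the commutator identity for functions. -/
theorem coordComp_eq_mvfderiv (hz : z ∈ (chartAt (E k) y).source) (μ : Fin k)
    (v : TangentSpace (𝓡 k) z) :
    coordComp y μ z v = mvfderiv (𝓡 k) (fun x => extChartAt (𝓡 k) y x μ) z v := by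
  rw [coordComp_eq hz, TangentBundle.continuousLinearMapAt_trivializationAt hz]
  have h := (mdifferentiableAt_extChartAt (I := 𝓡 k) hz)
  have h2 := mfderiv_comp_apply (I := 𝓡 k) (I' := 𝓘(ℝ, E k)) (I'' := 𝓘(ℝ, ℝ)) z
    (EuclideanSpace.proj (𝕜 := ℝ) μ : E k →L[ℝ] ℝ).mdifferentiableAt h v
  rw [ContinuousLinearMap.mfderiv_eq] at h2
  exact h2.symm

end Chart

/-! ### The Levi-Civita derivative along a map -/

namespace LorentzMetric

variable {k : ℕ} {M : Type*} [TopologicalSpace M] [ChartedSpace (E k) M] [IsManifold (𝓡 k) ∞ M]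
  (g : LorentzMetric k M) {y z : M}

/-- A nonzero such `v` would be orthogonal to a timelike vector, hence have positive square, yet it
is orthogonal to itself. -/
theorem eq_zero_of_forall {v : TangentSpace (𝓡 k) y} (hv : ∀ w, g.g y v w = 0) : v = 0 := by
  obtain ⟨u, -, hu⟩ := g.lorentz y
  by_contra h
  exact (hu v (by rw [g.symm, hv]) h).ne' (hv v)

theorem comp_symm (y z : M) (μ ν : Fin k) : g.comp y z μ ν = g.comp y z ν μ := g.symm _ _ _

theorem dcomp_symm (y : M) (σ μ ν : Fin k) : g.dcomp y σ μ ν = g.dcomp y σ ν μ := by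
  unfold dcomp
  rw [funext fun z => g.comp_symm y z μ ν]

theorem comp_diff (y : M) (μ ν : Fin k) : DiffFn (k := k) (fun z => g.comp y z μ ν) y :=
  g.smooth.apply_diff (coordField_diff y μ) (coordField_diff y ν)

theorem apply_eq_sum (hz : z ∈ (chartAt (E k) y).source) (v w : TangentSpace (𝓡 k) z) :
    g.g z v w = ∑ μ, ∑ ν, g.comp y z μ ν * coordComp y μ z v * coordComp y ν z w := by
  conv_lhs => rw [← sum_coordComp_smul_coordField hz v, ← sum_coordComp_smul_coordField hz w]
  simp only [map_sum, map_smul, sum_apply, smul_apply, smul_eq_mul,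
    Finset.mul_sum]
  rw [Finset.sum_comm]
  refine Finset.sum_congr rfl fun μ _ => Finset.sum_congr rfl fun ν _ => ?_
  change _ * (_ * g.comp y z μ ν) = _
  ring

theorem det_comp_ne_zero (y : M) : (g.comp y y).det ≠ 0 := by
  intro h
  obtain ⟨a, ha, h0⟩ := Matrix.exists_mulVec_eq_zero_iff.2 h
  have hy := mem_chart_source (E k) y
  have hu : ∑ μ, a μ • coordField y μ y = 0 := by
    refine g.eq_zero_of_forall fun w => ?_
    rw [g.symm, g.apply_eq_sum hy]
    simp only [coordComp_sum_smul_coordField hy]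
    refine Finset.sum_eq_zero fun μ _ => ?_
    have := congrFun h0 μ
    simp only [Matrix.mulVec, dotProduct, Pi.zero_apply] at this
    simp only [mul_right_comm, ← Finset.sum_mul, this, zero_mul]
  refine ha (funext fun ν => ?_)
  rw [← coordComp_sum_smul_coordField hy a ν, hu, ← zero_smul ℝ (0 : TangentSpace (𝓡 k) y),
    coordComp_smul hy, zero_mul]
  rfl

/-- The Christoffel symbols of the first kind. -/
theorem sum_comp_mul_christoffel (y : M) (τ σ ρ : Fin k) :
    ∑ μ, g.comp y y μ τ * g.christoffel y μ σ ρ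
      = (1 / 2) * (g.dcomp y σ ρ τ + g.dcomp y ρ σ τ - g.dcomp y τ σ ρ) := by
  let a : Fin k → ℝ := fun ν => g.dcomp y σ ρ ν + g.dcomp y ρ σ ν - g.dcomp y ν σ ρ
  have h1 : g.comp y y * (g.comp y y)⁻¹ = 1 :=
    Matrix.mul_nonsing_inv _ (isUnit_iff_ne_zero.2 (g.det_comp_ne_zero y))
  have h : (g.comp y y).mulVec ((g.comp y y)⁻¹.mulVec a) = a := by
    rw [Matrix.mulVec_mulVec, h1, Matrix.one_mulVec]
  have h' := congrFun h τ
  simp only [Matrix.mulVec, dotProduct] at h'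
  change _ = (1 / 2) * a τ
  rw [← h', Finset.mul_sum]
  refine Finset.sum_congr rfl fun μ _ => ?_
  rw [g.comp_symm y y τ μ]
  unfold christoffel
  ring

/-- The metric at `y` in terms of components. -/
def coordForm (y : M) (a b : Fin k → ℝ) : ℝ := ∑ μ, ∑ ν, g.comp y y μ ν * a μ * b ν

/-- The coordinate derivative of the metric at `y` in terms of components. -/
def coordDer (y : M) (a b c : Fin k → ℝ) : ℝ :=
  ∑ σ, ∑ μ, ∑ ν, g.dcomp y σ μ ν * a σ * b μ * c ν

theorem apply_eq_coordForm (v w : TangentSpace (𝓡 k) y) :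
    g.g y v w = g.coordForm y (fun μ => coordComp y μ y v) (fun μ => coordComp y μ y w) :=
  g.apply_eq_sum (mem_chart_source _ y) v w

theorem coordForm_symm (y : M) (a b : Fin k → ℝ) : g.coordForm y a b = g.coordForm y b a := by
  unfold coordForm
  rw [Finset.sum_comm]
  refine Finset.sum_congr rfl fun μ _ => Finset.sum_congr rfl fun ν _ => ?_
  rw [g.comp_symm]
  ring

theorem coordForm_sub_left (y : M) (a a' b : Fin k → ℝ) :
    g.coordForm y (fun μ => a μ - a' μ) b = g.coordForm y a b - g.coordForm y a' b := by
  unfold coordForm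
  simp only [← Finset.sum_sub_distrib]
  refine Finset.sum_congr rfl fun μ _ => Finset.sum_congr rfl fun ν _ => ?_
  ring

theorem coordDer_symm (y : M) (a b c : Fin k → ℝ) :
    g.coordDer y a b c = g.coordDer y a c b := by
  unfold coordDer
  refine Finset.sum_congr rfl fun σ _ => ?_
  rw [Finset.sum_comm]
  refine Finset.sum_congr rfl fun μ _ => Finset.sum_congr rfl fun ν _ => ?_
  rw [g.dcomp_symm]
  ring

theorem coordDer_eq (y : M) (a b c : Fin k → ℝ) :
    g.coordDer y a b c = ∑ μ, ∑ ν, (∑ σ, a σ * g.dcomp y σ μ ν) * b μ * c ν := by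
  unfold coordDer
  simp only [Finset.sum_mul]
  rw [Finset.sum_comm]
  refine Finset.sum_congr rfl fun μ _ => ?_
  rw [Finset.sum_comm]
  refine Finset.sum_congr rfl fun ν _ => Finset.sum_congr rfl fun σ _ => ?_
  ring

/-- Lowering the index replaces the Christoffel symbols by those of the first kind. From here on the
inverse metric no longer appears, and metricity and torsion become symmetry properties of
`coordDer`. -/
theorem coordForm_christoffel (y : M) (a x v w : Fin k → ℝ) :
    g.coordForm y (fun μ => a μ + ∑ σ, ∑ ρ, g.christoffel y μ σ ρ * x σ * v ρ) w
      = g.coordForm y a w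
        + (1 / 2) * (g.coordDer y x v w + g.coordDer y v x w - g.coordDer y w x v) := by
  have e1 : g.coordDer y v x w
      = ∑ σ, ∑ ρ, ∑ τ, g.dcomp y ρ σ τ * x σ * v ρ * w τ := by
    unfold coordDer
    rw [Finset.sum_comm]
    refine Finset.sum_congr rfl fun σ _ => Finset.sum_congr rfl fun ρ _ =>
      Finset.sum_congr rfl fun τ _ => ?_
    ring
  have e2 : g.coordDer y w x v
      = ∑ σ, ∑ ρ, ∑ τ, g.dcomp y τ σ ρ * x σ * v ρ * w τ := by
    unfold coordDer
    rw [Finset.sum_comm]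
    refine Finset.sum_congr rfl fun σ _ => ?_
    rw [Finset.sum_comm]
    refine Finset.sum_congr rfl fun ρ _ => Finset.sum_congr rfl fun τ _ => ?_
    ring
  have e3 : ∑ μ, ∑ τ, g.comp y y μ τ * (∑ σ, ∑ ρ, g.christoffel y μ σ ρ * x σ * v ρ) * w τ
      = ∑ σ, ∑ ρ, ∑ τ, (∑ μ, g.comp y y μ τ * g.christoffel y μ σ ρ) * x σ * v ρ * w τ := by
    simp only [Finset.mul_sum, Finset.sum_mul]
    simp only [← mul_assoc]
    have : ∀ μ, (∑ τ, ∑ σ, ∑ ρ, g.comp y y μ τ * g.christoffel y μ σ ρ * x σ * v ρ * w τ)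
        = ∑ σ, ∑ ρ, ∑ τ, g.comp y y μ τ * g.christoffel y μ σ ρ * x σ * v ρ * w τ := by
      intro μ
      rw [Finset.sum_comm]
      exact Finset.sum_congr rfl fun σ _ => Finset.sum_comm
    simp only [this]
    rw [Finset.sum_comm]
    refine Finset.sum_congr rfl fun σ _ => ?_
    rw [Finset.sum_comm]
    exact Finset.sum_congr rfl fun ρ _ => Finset.sum_comm
  have e4 : g.coordForm y (fun μ => a μ + ∑ σ, ∑ ρ, g.christoffel y μ σ ρ * x σ * v ρ) w
      = g.coordForm y a w
        + ∑ μ, ∑ τ, g.comp y y μ τ * (∑ σ, ∑ ρ, g.christoffel y μ σ ρ * x σ * v ρ) * w τ := by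
    unfold coordForm
    simp only [← Finset.sum_add_distrib]
    refine Finset.sum_congr rfl fun μ _ => Finset.sum_congr rfl fun τ _ => ?_
    ring
  rw [e4, e3, e1, e2]
  simp only [sum_comp_mul_christoffel]
  unfold coordDer
  simp only [← Finset.sum_add_distrib, ← Finset.sum_sub_distrib, Finset.mul_sum]
  congr 1
  refine Finset.sum_congr rfl fun σ _ => Finset.sum_congr rfl fun ρ _ =>
    Finset.sum_congr rfl fun τ _ => ?_
  ring

end LorentzMetric

section Along

variable {d : ℕ} {N : Type u} [TopologicalSpace N] [ChartedSpace (E (d + 1)) N]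
  [IsManifold (𝓡 (d + 1)) ∞ N]
  {M : Type v} [TopologicalSpace M] [ChartedSpace (E (d + 2)) M] [IsManifold (𝓡 (d + 2)) ∞ M]
  {g : LorentzMetric (d + 2) M} {φ : N → M} {V W : VFAlong (d + 2) φ} {X Z : VF (d + 1) N} {p : N}

/-- Differentiability at a point of a vector field along a map. -/
def DiffAlong (φ : N → M) (V : VFAlong (d + 2) φ) (p : N) : Prop :=
  MDifferentiableAt (𝓡 (d + 1)) (𝓡 (d + 2)).tangent
    (fun q => (⟨φ q, V q⟩ : TangentBundle (𝓡 (d + 2)) M)) p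

omit [IsManifold (𝓡 (d + 1)) ∞ N] in
theorem DiffAlong.coordComp (hV : DiffAlong φ V p) (μ : Fin (d + 2)) :
    DiffFn (k := d + 1) (fun q => coordComp (φ p) μ (φ q) (V q)) p := by
  have h := ((mdifferentiableAt_totalSpace _ _).1 hV).2
  exact (EuclideanSpace.proj (𝕜 := ℝ) μ : E (d + 2) →L[ℝ] ℝ).mdifferentiableAt.comp p h

theorem push_diffAlong (hφ : ContMDiff (𝓡 (d + 1)) (𝓡 (d + 2)) ∞ φ) (hX : SmoothVF X) (p : N) :
    DiffAlong φ (push φ X) p :=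
  ((hφ.contMDiff_tangentMap (m := ∞) (by simp)).comp hX).mdifferentiable (by simp) p

/-- The coordinate vector of a tangent vector at `y`. -/
abbrev coords (y : M) (v : TangentSpace (𝓡 (d + 2)) y) : Fin (d + 2) → ℝ :=
  fun μ => coordComp y μ y v

omit [IsManifold (𝓡 (d + 1)) ∞ N] in
theorem apply_covAlong (hv : TangentSpace (𝓡 (d + 2)) (φ p)) :
    g.g (φ p) (covAlong g φ X V p) hv
      = g.coordForm (φ p) (dcompAlong φ X V p) (coords (φ p) hv)
        + (1 / 2) * (g.coordDer (φ p) (coords (φ p) (push φ X p)) (coords (φ p) (V p))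
              (coords (φ p) hv)
            + g.coordDer (φ p) (coords (φ p) (V p)) (coords (φ p) (push φ X p)) (coords (φ p) hv)
            - g.coordDer (φ p) (coords (φ p) hv) (coords (φ p) (push φ X p))
              (coords (φ p) (V p))) := by
  rw [← g.coordForm_christoffel, g.apply_eq_coordForm]
  congr 1
  funext μ
  exact coordComp_sum_smul_coordField (mem_chart_source _ _) _ μ

omit [IsManifold (𝓡 (d + 1)) ∞ N] in
theorem dirDeriv_comp_comp (hφ : ContMDiff (𝓡 (d + 1)) (𝓡 (d + 2)) ∞ φ) (X : VF (d + 1) N) (p : N)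
    (μ ν : Fin (d + 2)) :
    dirDeriv X (fun q => g.comp (φ p) (φ q) μ ν) p
      = ∑ σ, coords (φ p) (push φ X p) σ * g.dcomp (φ p) σ μ ν := by
  have h := mvfderiv_comp_apply (g := fun z => g.comp (φ p) z μ ν) (f := φ) p
    (g.comp_diff (φ p) μ ν) (hφ.mdifferentiable (by simp) p) (X p)
  have h2 := sum_coordComp_smul_coordField (mem_chart_source _ _) (push φ X p)
  change dirDeriv X _ p = mvfderiv (𝓡 (d + 2)) _ (φ p) (push φ X p) at h
  rw [← h2, map_sum] at h
  simp only [map_smul] at h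
  exact h

omit [IsManifold (𝓡 (d + 1)) ∞ N] in
/-- The Levi-Civita derivative along a map is metric. -/
theorem dirDeriv_metric_along (hφ : ContMDiff (𝓡 (d + 1)) (𝓡 (d + 2)) ∞ φ) (hV : DiffAlong φ V p)
    (hW : DiffAlong φ W p) :
    dirDeriv X (fun q => g.g (φ q) (V q) (W q)) p
      = g.g (φ p) (covAlong g φ X V p) (W p) + g.g (φ p) (V p) (covAlong g φ X W p) := by
  have hc : ∀ μ ν, DiffFn (k := d + 1) (fun q => g.comp (φ p) (φ q) μ ν) p := fun μ ν =>
    MDifferentiableAt.comp p (g.comp_diff (φ p) μ ν) (hφ.mdifferentiable (by simp) p)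
  have e : (fun q => g.g (φ q) (V q) (W q)) =ᶠ[nhds p] fun q => ∑ μ, ∑ ν,
      g.comp (φ p) (φ q) μ ν * coordComp (φ p) μ (φ q) (V q) * coordComp (φ p) ν (φ q) (W q) := by
    filter_upwards [hφ.continuous.continuousAt.preimage_mem_nhds
      (baseSet_mem_nhds (k := d + 2) (φ p))] with q hq
    exact g.apply_eq_sum hq _ _
  have dV := hV.coordComp
  have dW := hW.coordComp
  have hd := fun μ ν => ((hc μ ν).mul (dV μ)).mul (dW ν)
  have l : dirDeriv X (fun q => g.g (φ q) (V q) (W q)) p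
      = g.coordDer (φ p) (coords (φ p) (push φ X p)) (coords (φ p) (V p)) (coords (φ p) (W p))
        + g.coordForm (φ p) (dcompAlong φ X V p) (coords (φ p) (W p))
        + g.coordForm (φ p) (coords (φ p) (V p)) (dcompAlong φ X W p) := by
    rw [dirDeriv_congr X e,
      dirDeriv_fun_sum X _ fun μ _ => DiffFn.sum _ fun ν _ => hd μ ν]
    rw [g.coordDer_eq]
    unfold LorentzMetric.coordForm
    simp only [← Finset.sum_add_distrib]
    refine Finset.sum_congr rfl fun μ _ => ?_
    rw [dirDeriv_fun_sum X _ fun ν _ => hd μ ν]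
    refine Finset.sum_congr rfl fun ν _ => ?_
    rw [dirDeriv_fun_mul X ((hc μ ν).mul (dV μ)) (dW ν), dirDeriv_fun_mul X (hc μ ν) (dV μ),
      dirDeriv_comp_comp hφ]
    unfold dcompAlong
    ring
  rw [l, g.symm (φ p) (V p), apply_covAlong, apply_covAlong,
    g.coordForm_symm _ (coords (φ p) (V p)),
    g.coordDer_symm _ (coords (φ p) (push φ X p)) (coords (φ p) (W p)),
    g.coordDer_symm _ (coords (φ p) (V p)) _ (coords (φ p) (W p)),
    g.coordDer_symm _ (coords (φ p) (W p)) _ (coords (φ p) (V p))]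
  ring

/-- The Levi-Civita derivative along a map is torsion free. -/
theorem push_bracket [T2Space N] (hφ : ContMDiff (𝓡 (d + 1)) (𝓡 (d + 2)) ∞ φ) (hX : SmoothVF X)
    (hZ : SmoothVF Z) (p : N) :
    push φ (bracket X Z) p = covAlong g φ X (push φ Z) p - covAlong g φ Z (push φ X) p := by
  have hs : φ ⁻¹' (chartAt (E (d + 2)) (φ p)).source ∈ nhds p :=
    hφ.continuous.continuousAt.preimage_mem_nhds (baseSet_mem_nhds (k := d + 2) (φ p))
  have key : ∀ μ, coordComp (φ p) μ (φ p) (push φ (bracket X Z) p)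
      = dcompAlong φ X (push φ Z) p μ - dcompAlong φ Z (push φ X) p μ := by
    intro μ
    let f : N → ℝ := fun q => extChartAt (𝓡 (d + 2)) (φ p) (φ q) μ
    have hf : ContMDiffOn (𝓡 (d + 1)) 𝓘(ℝ, ℝ) ∞ f
        (φ ⁻¹' (chartAt (E (d + 2)) (φ p)).source) :=
      (EuclideanSpace.proj (𝕜 := ℝ) μ : E (d + 2) →L[ℝ] ℝ).contMDiff.comp_contMDiffOn
        ((contMDiffOn_extChartAt (I := 𝓡 (d + 2)) (x := φ p)).comp hφ.contMDiffOn
          (fun q hq => hq))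
    have ec : ∀ (A : VF (d + 1) N) (q : N), φ q ∈ (chartAt (E (d + 2)) (φ p)).source →
        coordComp (φ p) μ (φ q) (push φ A q) = dirDeriv A f q := by
      intro A q hq
      rw [coordComp_eq_mvfderiv hq]
      refine (mvfderiv_comp_apply (g := fun x => extChartAt (𝓡 (d + 2)) (φ p) x μ) (f := φ) q
        ?_ (hφ.mdifferentiable (by simp) q) (A q)).symm
      exact (EuclideanSpace.proj (𝕜 := ℝ) μ : E (d + 2) →L[ℝ] ℝ).mdifferentiableAt.comp _
        (mdifferentiableAt_extChartAt hq)
    -- The pulled-back coordinate is smooth only near `p`, while `dirDeriv_bracket` asks for a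
    -- global function; second derivatives at `p` see only the germ.
    obtain ⟨h, hh, hhf⟩ := exists_smoothFn_eventuallyEq hs hf
    have ed : ∀ A B : VF (d + 1) N,
        dcompAlong φ A (push φ B) p μ = dirDeriv A (dirDeriv B h) p := by
      intro A B
      refine dirDeriv_congr A ?_
      filter_upwards [hs, hhf.eventuallyEq_nhds] with q hq hq'
      rw [ec B q hq, dirDeriv_congr B hq']
    rw [ec _ p (mem_chart_source _ _), ← dirDeriv_congr _ hhf, dirDeriv_bracket hX hZ hh, ed, ed]
  refine sub_eq_zero.1 (g.eq_zero_of_forall fun w => ?_)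
  rw [map_sub, map_sub, sub_apply, sub_apply, apply_covAlong, apply_covAlong,
    g.apply_eq_coordForm, funext key, g.coordForm_sub_left,
    g.coordDer_symm _ (coords (φ p) w) (coords (φ p) (push φ Z p))]
  ring

omit [IsManifold (𝓡 (d + 1)) ∞ N] in
/-- `φ^*(£_ζ g)` in terms of the Levi-Civita derivative of `ζ`. -/
theorem pullLieMetric_eq (V : VFAlong (d + 2) φ) (X Z : VF (d + 1) N) (p : N) :
    pullLieMetric g φ V X Z p = g.g (φ p) (covAlong g φ X V p) (push φ Z p)
      + g.g (φ p) (push φ X p) (covAlong g φ Z V p) := by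
  have l : pullLieMetric g φ V X Z p
      = g.coordDer (φ p) (coords (φ p) (V p)) (coords (φ p) (push φ X p))
          (coords (φ p) (push φ Z p))
        + g.coordForm (φ p) (dcompAlong φ X V p) (coords (φ p) (push φ Z p))
        + g.coordForm (φ p) (coords (φ p) (push φ X p)) (dcompAlong φ Z V p) := by
    rw [g.coordDer_eq]
    unfold LorentzMetric.coordForm pullLieMetric
    simp only [← Finset.sum_add_distrib]
  rw [l, g.symm (φ p) (push φ X p), apply_covAlong, apply_covAlong,
    g.coordForm_symm _ (coords (φ p) (push φ X p)),
    g.coordDer_symm _ (coords (φ p) (push φ X p)) (coords (φ p) (V p)),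
    g.coordDer_symm _ (coords (φ p) (push φ Z p)) (coords (φ p) (V p)),
    g.coordDer_symm _ (coords (φ p) (V p)) (coords (φ p) (push φ Z p))]
  ring

end Along

/-! ### Embedded null hypersurface data -/

theorem NullData.mem_rad_of_null {m : ℕ} {N : Type*} [TopologicalSpace N] [ChartedSpace (E m) N]
    [IsManifold (𝓡 m) ∞ N] (D : NullData m N) {p : N} {v : TangentSpace (𝓡 m) p}
    (hv : D.γ p v v = 0) : v ∈ D.rad p := by
  intro w
  by_contra h
  -- For null `v` the square of `w + t • v` is affine in `t`; this `t` makes it equal to `-1`.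
  set t : ℝ := -(D.γ p w w + 1) / (2 * D.γ p v w) with ht
  have e : t * (2 * D.γ p v w) = -(D.γ p w w + 1) := div_mul_cancel₀ _ (by simpa using h)
  have h1 := D.γ_nonneg p (w + t • v)
  simp only [map_add, map_smul, add_apply, smul_apply, smul_eq_mul, hv, D.γ_symm p w v] at h1
  linarith

section Embedded

variable {d : ℕ} {N : Type u} [TopologicalSpace N] [ChartedSpace (E (d + 1)) N]
  [IsManifold (𝓡 (d + 1)) ∞ N]
  {M : Type v} [TopologicalSpace M] [ChartedSpace (E (d + 2)) M] [IsManifold (𝓡 (d + 2)) ∞ M]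
  {D : NullData (d + 1) N} {g : LorentzMetric (d + 2) M} {φ : N → M} {ζ : VFAlong (d + 2) φ}
  {η X W Z : VF (d + 1) N} {p : N}

namespace IsEmbedded

variable (h : IsEmbedded D g φ ζ)
include h

theorem contMDiff : ContMDiff (𝓡 (d + 1)) (𝓡 (d + 2)) ∞ φ := h.embedding.contMDiff

theorem rig_diffAlong (p : N) : DiffAlong φ ζ p := h.rig_smooth.mdifferentiable (by simp) p

theorem g_push_push (X W : VF (d + 1) N) (p : N) :
    g.g (φ p) (push φ X p) (push φ W p) = D.γ p (X p) (W p) := (h.pull_γ p _ _).symm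

theorem g_rig_push (X : VF (d + 1) N) (p : N) :
    g.g (φ p) (ζ p) (push φ X p) = D.ell p (X p) := (h.pull_ell p _).symm

theorem normalDirs_eq : normalDirs g φ = D.rad :=
  funext fun p => Set.ext fun v => forall_congr' fun w => by rw [h.pull_γ]

theorem isNullHypersurface : IsNullHypersurface g φ := by
  refine ⟨h.embedding, fun p => ⟨D.n p, ?_, D.n_ne_zero p⟩⟩
  rw [h.normalDirs_eq]
  exact D.γ_n_left p

theorem mfderiv_injective (p : N) :
    Function.Injective (mfderiv (𝓡 (d + 1)) (𝓡 (d + 2)) φ p) := by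
  refine (injective_iff_map_eq_zero _).2 fun v hv => D.eq_zero_of_rad p v (fun w => ?_) ?_
  · rw [h.pull_γ, hv, map_zero, zero_apply]
  · rw [h.pull_ell, hv, map_zero]

/-- The tangent space of the spacetime is spanned by the hypersurface and the rigging. -/
theorem exists_decomposition (p : N) (u : TangentSpace (𝓡 (d + 2)) (φ p)) :
    ∃ (v : TangentSpace (𝓡 (d + 1)) p) (a : ℝ),
      u = mfderiv (𝓡 (d + 1)) (𝓡 (d + 2)) φ p v + a • ζ p := by
  let T : (E (d + 1) × ℝ) →ₗ[ℝ] E (d + 2) :=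
    LinearMap.coprod (mfderiv (𝓡 (d + 1)) (𝓡 (d + 2)) φ p : E (d + 1) →L[ℝ] E (d + 2)).toLinearMap
      (LinearMap.toSpanSingleton ℝ (E (d + 2)) (ζ p))
  have hT : Function.Injective T := by
    -- The spacetime metric pulled back by `T` is `𝒜`, so a kernel vector of `T` lies in the radical
    -- of `𝒜`. Surjectivity then follows by counting dimensions.
    refine (injective_iff_map_eq_zero _).2 fun x hx => (D.nondeg p).1 x fun z => ?_
    have hx' : mfderiv (𝓡 (d + 1)) (𝓡 (d + 2)) φ p x.1 + x.2 • ζ p = 0 := hx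
    have h1 := congrArg (fun u => g.g (φ p) u
      (mfderiv (𝓡 (d + 1)) (𝓡 (d + 2)) φ p z.1 + z.2 • ζ p)) hx'
    simp only [map_add, map_smul, add_apply, smul_apply, smul_eq_mul, map_zero, zero_apply,
      g.symm (φ p) _ (ζ p), ← h.pull_ell, ← h.pull_ell2] at h1
    change D.γ p x.1 z.1 + x.2 * D.ell p z.1 + z.2 * D.ell p x.1 + x.2 * z.2 * D.ell2 p = 0
    linear_combination h1 + h.pull_γ p x.1 z.1 + z.2 * h.pull_ell p x.1
  have hs : Function.Surjective T :=
    (LinearMap.injective_iff_surjective_of_finrank_eq_finrank (by simp)).1 hT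
  obtain ⟨x, hx⟩ := hs u
  exact ⟨x.1, x.2, hx.symm⟩

theorem ext_push_rig {u w : TangentSpace (𝓡 (d + 2)) (φ p)}
    (h1 : ∀ z, g.g (φ p) u (mfderiv (𝓡 (d + 1)) (𝓡 (d + 2)) φ p z)
      = g.g (φ p) w (mfderiv (𝓡 (d + 1)) (𝓡 (d + 2)) φ p z))
    (h2 : g.g (φ p) u (ζ p) = g.g (φ p) w (ζ p)) : u = w := by
  refine sub_eq_zero.1 (g.eq_zero_of_forall fun x => ?_)
  obtain ⟨v, a, rfl⟩ := h.exists_decomposition p x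
  simp only [map_sub, sub_apply, map_add, map_smul, h1, h2, sub_self, smul_zero, add_zero]

variable [T2Space N]

omit [T2Space N] in
theorem dirDeriv_γ_eq (hW : SmoothVF W) (hZ : SmoothVF Z) (p : N) :
    dirDeriv X (fun q => D.γ q (W q) (Z q)) p
      = g.g (φ p) (covAlong g φ X (push φ W) p) (push φ Z p)
        + g.g (φ p) (covAlong g φ X (push φ Z) p) (push φ W p) := by
  rw [g.symm _ (covAlong g φ X (push φ Z) p), ← dirDeriv_metric_along h.contMDiff
    (push_diffAlong h.contMDiff hW p) (push_diffAlong h.contMDiff hZ p)]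
  exact congrArg (fun f => dirDeriv X f p) (funext fun q => (h.g_push_push W Z q).symm)

theorem γ_bracket_eq (hX : SmoothVF X) (hW : SmoothVF W) (Z : VF (d + 1) N) (p : N) :
    D.γ p (bracket X W p) (Z p) = g.g (φ p) (covAlong g φ X (push φ W) p) (push φ Z p)
      - g.g (φ p) (covAlong g φ W (push φ X) p) (push φ Z p) := by
  rw [← h.g_push_push, push_bracket (g := g) h.contMDiff hX hW, map_sub, sub_apply]

omit [T2Space N] in
theorem dirDeriv_ell_eq (hW : SmoothVF W) (p : N) :
    dirDeriv X (fun q => D.ell q (W q)) p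
      = g.g (φ p) (covAlong g φ X ζ p) (push φ W p)
        + g.g (φ p) (ζ p) (covAlong g φ X (push φ W) p) := by
  rw [← dirDeriv_metric_along h.contMDiff (h.rig_diffAlong p) (push_diffAlong h.contMDiff hW p)]
  exact congrArg (fun f => dirDeriv X f p) (funext fun q => (h.g_rig_push W q).symm)

theorem ell_bracket_eq (hX : SmoothVF X) (hW : SmoothVF W) (p : N) :
    D.ell p (bracket X W p) = g.g (φ p) (ζ p) (covAlong g φ X (push φ W) p)
      - g.g (φ p) (ζ p) (covAlong g φ W (push φ X) p) := by
  rw [← h.g_rig_push, push_bracket (g := g) h.contMDiff hX hW, map_sub]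

/-- The Koszul formula. -/
theorem g_covAlong_push (hX : SmoothVF X) (hW : SmoothVF W) (hZ : SmoothVF Z) (p : N) :
    g.g (φ p) (covAlong g φ X (push φ W) p) (push φ Z p) = D.koszul X W Z p := by
  unfold NullData.koszul
  rw [h.dirDeriv_γ_eq hW hZ, h.dirDeriv_γ_eq hX hZ, h.dirDeriv_γ_eq hX hW, h.γ_bracket_eq hX hW,
    h.γ_bracket_eq hX hZ, h.γ_bracket_eq hW hZ]
  ring

/-- Differentiating `ℓ(W) = g(ζ, W)` moves the derivative onto `ζ`. After symmetrising in `X` and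
`W`, the derivatives of `ζ` form `½ φ^*(£_ζ g) = Y`. -/
theorem g_covAlong_rig (hX : SmoothVF X) (hW : SmoothVF W) (p : N) :
    g.g (φ p) (covAlong g φ X (push φ W) p) (ζ p) = D.koszulEll X W p - D.Y p (X p) (W p) := by
  have hY := h.pull_Y X W hX hW p
  rw [pullLieMetric_eq, g.symm _ (push φ X p)] at hY
  unfold NullData.koszulEll
  rw [g.symm, h.dirDeriv_ell_eq hW, h.dirDeriv_ell_eq hX, h.ell_bracket_eq hX hW]
  linear_combination hY

/-- The Gauss equation for totally geodesic null hypersurfaces. -/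
theorem isInducedConnection_nabBar (hU : D.UVanishes) : IsInducedConnection g φ D.nabBar := by
  intro X W hX hW p
  refine h.ext_push_rig (fun z => ?_) ?_
  · obtain ⟨Z, hZ, rfl⟩ := exists_smooth_apply_eq p z
    refine Eq.trans (h.g_push_push (D.nabBar X W) Z p)
      (Eq.trans ?_ (h.g_covAlong_push hX hW hZ p).symm)
    unfold NullData.nabBar
    rw [map_sub, map_smul, sub_apply, smul_apply, NullData.γ_n_left, NullData.γ_nab hX hW hZ,
      hU X W hX hW]
    simp
  · rw [h.g_covAlong_rig hX hW, g.symm, h.g_rig_push, ← NullData.ell_nab_of_uVanishes hU hX hW]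
    unfold NullData.nabBar
    rw [map_sub, map_smul, NullData.ell_n, smul_eq_mul, mul_one]

/-- An induced connection is constrained only on smooth fields, so uniqueness, from injectivity of
the differential of `φ`, is limited to those. -/
theorem eq_nabBar {D' : VF (d + 1) N → VF (d + 1) N → VF (d + 1) N} (hU : D.UVanishes)
    (hD : IsInducedConnection g φ D') (hX : SmoothVF X) (hW : SmoothVF W) :
    D' X W = D.nabBar X W :=
  funext fun p => h.mfderiv_injective p
    ((hD X W hX hW p).trans (h.isInducedConnection_nabBar hU X W hX hW p).symm)

/-- With normal `n`, the second fundamental form is `koszul X n W`, which equals `U(X, W)` on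
differentiating `γ(W, n) = 0`. Conversely, if `U = 0`, the derivative of any null normal is a
multiple of `n`, hence orthogonal to the hypersurface. -/
theorem isTotallyGeodesic_iff : IsTotallyGeodesic g φ ↔ D.UVanishes := by
  constructor
  · intro hK X W hX hW p
    have hn : SmoothVF D.n := D.n_smooth
    have h0 := hK D.n X W hn hX hW (fun q => by rw [h.normalDirs_eq]; exact D.γ_n_left q) p
    rw [h.g_covAlong_push hX hn hW] at h0
    have h1 := D.koszul_add_swap X W D.n p
    rw [h0, NullData.koszul_n] at h1
    simpa [NullData.γ_n_right, dirDeriv_fun_const] using h1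
  · intro hU ν X W hν hX hW hr p
    rw [h.normalDirs_eq] at hr
    rw [← h.isInducedConnection_nabBar hU X ν hX hν, h.g_push_push,
      NullData.nabBar_of_rad hU hν hr hX, map_smul, smul_apply, NullData.γ_n_left, smul_zero]

theorem isNEH_iff : IsNEH g φ ↔ D.UVanishes ∧ HasProductTopology D.rad := by
  unfold IsNEH
  rw [h.isTotallyGeodesic_iff, h.normalDirs_eq]
  exact and_iff_right h.isNullHypersurface

omit [T2Space N] in
theorem isNullGenerator_iff :
    IsNullGenerator g φ η ↔ SmoothVF η ∧ (∀ p, η p ∈ D.rad p) ∧ ∀ p, η p ≠ 0 := by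
  refine and_congr_right fun _ => and_congr_left fun _ => forall_congr' fun p => ?_
  rw [h.g_push_push]
  exact ⟨fun h0 => D.mem_rad_of_null h0, fun hr => hr _⟩

end IsEmbedded

end Embedded

/-! ### Isolated and weakly isolated horizons -/

section LieCommutes

variable {k : ℕ} {N : Type*} [TopologicalSpace N] [T2Space N] [ChartedSpace (E k) N]
  [IsManifold (𝓡 k) ∞ N] {D : VF k N → VF k N → VF k N} {η : VF k N}

/-- The vector half is the vanishing of `£_η D` rearranged. It implies the one-form half: contract
with `θ`, and the second derivatives of `θ(W)` cancel by the commutator identity. -/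
theorem lieCommutes_iff (hη : SmoothVF η)
    (hD : ∀ X W : VF k N, SmoothVF X → SmoothVF W → SmoothVF (D X W)) :
    LieCommutes D η ↔
      ∀ X W : VF k N, SmoothVF X → SmoothVF W → ∀ p, lieConnection D η X W p = 0 := by
  have e : ∀ (X W : VF k N) (p : N), lieConnection D η X W p = 0 ↔
      bracket η (D X W) p - D (bracket η X) W p = D X (bracket η W) p := fun X W p => by
    unfold lieConnection
    rw [sub_right_comm, sub_eq_zero]
  constructor
  · exact fun h X W hX hW p => (e X W p).2 (h.1 X W hX hW p)
  · refine fun h => ⟨fun X W hX hW p => (e X W p).1 (h X W hX hW p), ?_⟩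
    intro θ X W hθ hX hW p
    have hc := dirDeriv_bracket hη hX (hθ.apply hW) p
    have h1 := congrArg (θ p) (h X W hX hW p)
    unfold lieConnection at h1
    simp only [map_sub, map_zero] at h1
    have e1 := dirDeriv_fun_sub η (((hθ.apply hW).dirDeriv hX).diff p)
      ((hθ.apply (hD X W hX hW)).diff p)
    have e2 := dirDeriv_fun_sub X (((hθ.apply hW).dirDeriv hη).diff p)
      ((hθ.apply (hη.bracket hW)).diff p)
    unfold lieOneForm
    simp only
    rw [e1, e2, hc]
    linear_combination -h1

end LieCommutes

/-! ### Horizon criteria in terms of the data -/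

section Embedded

variable {d : ℕ} {N : Type u} [TopologicalSpace N] [T2Space N] [ChartedSpace (E (d + 1)) N]
  [IsManifold (𝓡 (d + 1)) ∞ N]
  {M : Type v} [TopologicalSpace M] [ChartedSpace (E (d + 2)) M] [IsManifold (𝓡 (d + 2)) ∞ M]
  {D : NullData (d + 1) N} {g : LorentzMetric (d + 2) M} {φ : N → M} {ζ : VFAlong (d + 2) φ}
  {η X : VF (d + 1) N} {ϖ : OneForm (d + 1) N} {p : N}

namespace IsEmbedded

variable (h : IsEmbedded D g φ ζ)
include h

theorem exists_lieCommutes_iff (hU : D.UVanishes) (hη : SmoothVF η) :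
    (∃ D' : VF (d + 1) N → VF (d + 1) N → VF (d + 1) N,
      IsInducedConnection g φ D' ∧ LieCommutes D' η) ↔
      ∀ X W : VF (d + 1) N, SmoothVF X → SmoothVF W → ∀ p, D.sigmaBar η X W p = 0 := by
  constructor
  · rintro ⟨D', hD, hc⟩ X W hX hW p
    have e := fun A B hA hB => h.eq_nabBar hU hD (X := A) (W := B) hA hB
    have h0 := (lieCommutes_iff hη fun A B hA hB => by
      rw [e A B hA hB]; exact NullData.nabBar_smooth hA hB).1 hc X W hX hW p
    unfold lieConnection at h0
    rwa [e X W hX hW, e X _ hX (hη.bracket hW), e _ W (hη.bracket hX) hW] at h0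
  · intro h0
    exact ⟨D.nabBar, h.isInducedConnection_nabBar hU,
      (lieCommutes_iff hη fun A B hA hB => NullData.nabBar_smooth hA hB).2 h0⟩

theorem isIsolated_iff :
    IsIsolated g φ η ↔ D.IsAKH1 η ∧ HasProductTopology D.rad ∧ ∀ p, η p ≠ 0 := by
  unfold IsIsolated NullData.IsAKH1
  rw [h.isNEH_iff, h.isNullGenerator_iff]
  constructor
  · rintro ⟨⟨hU, hP⟩, ⟨hη, hr, h0⟩, hD⟩
    exact ⟨⟨NullData.isAKH0_of_uVanishes hη hU hr h0, (NullData.sigmaBar_eq_zero_iff hU hη hr).1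
      ((h.exists_lieCommutes_iff hU hη).1 hD)⟩, hP, h0⟩
  · rintro ⟨⟨hA, hE⟩, hP, h0⟩
    have hU := hA.uVanishes
    exact ⟨⟨hU, hP⟩, ⟨hA.smooth, hA.mem_rad, h0⟩, (h.exists_lieCommutes_iff hU hA.smooth).2
      ((NullData.sigmaBar_eq_zero_iff hU hA.smooth hA.mem_rad).2 hE)⟩

variable (hU : D.UVanishes) (hη : SmoothVF η) (hr : ∀ p, η p ∈ D.rad p)
include hU hη hr

theorem exists_isVarpi : ∃ ϖ : OneForm (d + 1) N, IsVarpi g φ η ϖ := by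
  -- The witness is `dα/α + s - r`, with `s` written as `ℓ(∇°n)` to be a genuine linear form at each
  -- point. At zeros of `α` the inverse is `0` by convention, and nothing is required there.
  refine ⟨fun p => (D.alpha η p)⁻¹ • mvfderiv (𝓡 (d + 1)) (D.alpha η) p
    + (D.ell p).comp (D.conn D.n p) - D.Y p (D.n p), fun X hX p hp => ?_⟩
  have hα := (NullData.alpha_ne_zero hr).2 hp
  rw [← h.isInducedConnection_nabBar hU X η hX hη]
  refine Eq.trans ?_ (map_smul (mfderiv (𝓡 (d + 1)) (𝓡 (d + 2)) φ p) _ (η p))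
  refine congrArg (mfderiv (𝓡 (d + 1)) (𝓡 (d + 2)) φ p) ?_
  have hs : D.ell p (D.conn D.n p (X p)) = D.s X p := by
    change D.ell p (D.nab X D.n p) = _
    rw [NullData.nab_n hU hX, map_smul, D.ell_n, smul_eq_mul, mul_one]
  have he : η p = D.alpha η p • D.n p := D.eq_smul_n_of_rad (hr p)
  rw [NullData.nabBar_of_rad hU hη hr hX, he, smul_smul]
  congr 1
  simp only [sub_apply, add_apply, smul_apply, ContinuousLinearMap.comp_apply, hs, smul_eq_mul]
  unfold dirDeriv NullData.r
  field_simp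
  ring

/-- Injectivity of the differential of `φ` reduces the equation to `∇̄_X η = ϖ(X) η` on `N`;
contracting with `ℓ` and dividing by `α` gives the value. -/
theorem isVarpi_apply (hϖ : IsVarpi g φ η ϖ) (hα : D.alpha η p ≠ 0) (hX : SmoothVF X) :
    ϖ p (X p) = dirDeriv X (D.alpha η) p / D.alpha η p + D.s X p - D.r X p := by
  have h1 := hϖ X hX p ((NullData.alpha_ne_zero hr).1 hα)
  rw [← h.isInducedConnection_nabBar hU X η hX hη] at h1
  have h2 := h.mfderiv_injective p
    (h1.trans (map_smul (mfderiv (𝓡 (d + 1)) (𝓡 (d + 2)) φ p) _ (η p)).symm)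
  have h3 := congrArg (D.ell p) h2
  rw [NullData.nabBar_of_rad hU hη hr hX, map_smul, map_smul, D.ell_n, smul_eq_mul, smul_eq_mul,
    mul_one] at h3
  change _ = _ * D.alpha η p at h3
  field_simp
  linear_combination -h3

/-- The condition `α ≠ 0` is open, so the formula for `ϖ` holds near `p` and may be differentiated,
without any smoothness of `ϖ` being assumed. The term `κ_n dα` arises as `(s - r)(n) dα`. -/
theorem lieOneForm_isVarpi (hϖ : IsVarpi g φ η ϖ) (hα : D.alpha η p ≠ 0) (hX : SmoothVF X) :
    lieOneForm η ϖ X p = D.awkh1Expr (D.alpha η) X p := by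
  have ha : SmoothFn (k := d + 1) (D.alpha η) := NullData.alpha_smoothFn hη
  have hn : SmoothVF D.n := D.n_smooth
  have e : (fun q => ϖ q (X q)) =ᶠ[nhds p] fun q =>
      dirDeriv X (D.alpha η) q * (D.alpha η q)⁻¹ + (D.s X q - D.r X q) := by
    filter_upwards [(ContMDiff.continuous ha).continuousAt.eventually_ne hα] with q hq
    rw [h.isVarpi_apply hU hη hr hϖ hq hX, div_eq_mul_inv, add_sub_assoc]
  have di : DiffFn (k := d + 1) (fun q => (D.alpha η q)⁻¹) p :=
    (differentiableAt_inv hα).mdifferentiableAt.comp p (ha.diff p)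
  have dX := (ha.dirDeriv hX).diff p
  have dsr := ((NullData.s_smoothFn (D := D) hX).sub (NullData.r_smoothFn (D := D) hX)).diff p
  have hi : dirDeriv D.n (fun q => (D.alpha η q)⁻¹) p
      = -(D.alpha η p)⁻¹ * (D.alpha η p)⁻¹ * dirDeriv D.n (D.alpha η) p := by
    have h1 := dirDeriv_fun_mul D.n (ha.diff p) di
    have h2 : (fun q => D.alpha η q * (D.alpha η q)⁻¹) =ᶠ[nhds p] fun _ => (1 : ℝ) := by
      filter_upwards [(ContMDiff.continuous ha).continuousAt.eventually_ne hα] with q hq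
      exact mul_inv_cancel₀ hq
    rw [dirDeriv_congr _ h2, dirDeriv_fun_const] at h1
    field_simp
    field_simp at h1
    linear_combination -h1
  have hd : dirDeriv η (fun q => ϖ q (X q)) p
      = D.alpha η p * dirDeriv D.n (fun q => ϖ q (X q)) p := by
    conv_lhs => rw [NullData.eq_alpha_smul_n hr]
    exact dirDeriv_vf_smul _ _
  have hb : bracket η X p
      = D.alpha η p • bracket D.n X p - dirDeriv X (D.alpha η) p • D.n p := by
    conv_lhs => rw [NullData.eq_alpha_smul_n hr]
    rw [bracket_smul_left _ (ha.diff p) (hn.diff p)]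
    module
  have hk : D.r D.n p = - D.kappa p := (neg_neg _).symm
  unfold lieOneForm NullData.awkh1Expr
  rw [hd, dirDeriv_congr _ e, dirDeriv_fun_add _ (dX.mul di) dsr, dirDeriv_fun_mul _ dX di, hi, hb,
    map_sub, map_smul, map_smul, h.isVarpi_apply hU hη hr hϖ hα (hn.bracket hX),
    h.isVarpi_apply hU hη hr hϖ hα hn, D.s_n, hk, dirDeriv_bracket hn hX ha]
  simp only [smul_eq_mul]
  field_simp
  ring

omit hU hη hr in
theorem isWeaklyIsolated_iff :
    IsWeaklyIsolated g φ η ↔ D.IsAWKH1 η ∧ HasProductTopology D.rad ∧ ∀ p, η p ≠ 0 := by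
  unfold IsWeaklyIsolated NullData.IsAWKH1
  rw [h.isNEH_iff, h.isNullGenerator_iff]
  constructor
  · rintro ⟨⟨hU, hP⟩, ⟨hη, hr, h0⟩, ϖ, hϖ, hL⟩
    -- As `η` has no zeros, `α ≠ 0` everywhere and the pointwise formula for `£_η ϖ` holds on all of
    -- `N`.
    refine ⟨⟨NullData.isAKH0_of_uVanishes hη hU hr h0, fun X hX p => ?_⟩, hP, h0⟩
    rw [← h.lieOneForm_isVarpi hU hη hr hϖ ((NullData.alpha_ne_zero hr).2 (h0 p)) hX, hL X hX]
  · rintro ⟨⟨hA, hE⟩, hP, h0⟩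
    have hU := hA.uVanishes
    obtain ⟨ϖ, hϖ⟩ := h.exists_isVarpi hU hA.smooth hA.mem_rad
    refine ⟨⟨hU, hP⟩, ⟨hA.smooth, hA.mem_rad, h0⟩, ϖ, hϖ, fun X hX p => ?_⟩
    rw [h.lieOneForm_isVarpi hU hA.smooth hA.mem_rad hϖ
      ((NullData.alpha_ne_zero hA.mem_rad).2 (h0 p)) hX, hE X hX]

end IsEmbedded

end Embedded

end

end Horizons

/-! ### The theorem -/

open Horizons in
theorem mainTheorem10 {d : ℕ} {N : Type u} [TopologicalSpace N] [T2Space N]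
    [SecondCountableTopology N] [ConnectedSpace N] [ChartedSpace (E (d + 1)) N]
    [IsManifold (𝓡 (d + 1)) ∞ N] (D : NullData (d + 1) N) (η : VF (d + 1) N)
    (hη : SmoothVF η) :
    -- the metric hypersurface connection is well defined
    D.IsMetricConnection D.conn ∧
    -- `Σ̄ = (AKH₁ expression) ⊗ n` when `U = 0` and `η` is in the radical of `γ`
    (D.UVanishes → (∀ p, η p ∈ D.rad p) →
      (∀ X W : VF (d + 1) N, SmoothVF X → SmoothVF W → ∀ p,
        D.sigmaBar η X W p = D.akh1Expr (D.alpha η) X W p • D.n p) ∧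
      ((∀ X W : VF (d + 1) N, SmoothVF X → SmoothVF W → ∀ p, D.sigmaBar η X W p = 0) ↔
        ∀ X W : VF (d + 1) N, SmoothVF X → SmoothVF W → ∀ p,
          D.akh1Expr (D.alpha η) X W p = 0)) ∧
    (D.IsAKH0 η → D.UVanishes ∧
      ((∀ X W : VF (d + 1) N, SmoothVF X → SmoothVF W → ∀ p, D.sigmaBar η X W p = 0) ↔
        D.IsAKH1 η)) ∧
    -- the embedded case
    ∀ {M : Type v} [TopologicalSpace M] [T2Space M] [SecondCountableTopology M]
      [ConnectedSpace M] [ChartedSpace (E (d + 2)) M] [IsManifold (𝓡 (d + 2)) ∞ M]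
      (g : LorentzMetric (d + 2) M) (φ : N → M) (ζ : VFAlong (d + 2) φ),
      IsEmbedded D g φ ζ →
      -- `∇̄ = ∇° - Y n` is the induced connection
      (D.UVanishes → IsInducedConnection g φ D.nabBar) ∧
      (IsIsolated g φ η ↔ D.IsAKH1 η ∧ HasProductTopology D.rad ∧ ∀ p, η p ≠ 0) ∧
      (D.UVanishes → (∀ p, η p ∈ D.rad p) →
        (∃ ϖ : OneForm (d + 1) N, IsVarpi g φ η ϖ) ∧
        ∀ ϖ : OneForm (d + 1) N, IsVarpi g φ η ϖ → ∀ p, D.alpha η p ≠ 0 →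
          (∀ X : VF (d + 1) N, SmoothVF X →
            ϖ p (X p) = dirDeriv X (D.alpha η) p / D.alpha η p + D.s X p - D.r X p ∧
            lieOneForm η ϖ X p = D.awkh1Expr (D.alpha η) X p) ∧
          ((∀ X : VF (d + 1) N, SmoothVF X → lieOneForm η ϖ X p = 0) ↔
            ∀ X : VF (d + 1) N, SmoothVF X → D.awkh1Expr (D.alpha η) X p = 0)) ∧
      (IsWeaklyIsolated g φ η ↔
        D.IsAWKH1 η ∧ HasProductTopology D.rad ∧ ∀ p, η p ≠ 0) := by
  refine ⟨D.isMetricConnection_conn, fun hU hr => ⟨fun X W hX hW p =>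
    NullData.sigmaBar_eq hU hη hr hX hW p, NullData.sigmaBar_eq_zero_iff hU hη hr⟩,
    fun hA => ⟨hA.uVanishes, ?_⟩, ?_⟩
  · rw [NullData.sigmaBar_eq_zero_iff hA.uVanishes hη hA.mem_rad]
    exact (and_iff_right hA).symm
  · intro M _ _ _ _ _ _ g φ ζ h
    refine ⟨h.isInducedConnection_nabBar, h.isIsolated_iff, fun hU hr =>
      ⟨h.exists_isVarpi hU hη hr, fun ϖ hϖ p hα => ?_⟩, h.isWeaklyIsolated_iff⟩
    have hL := fun X (hX : SmoothVF X) => h.lieOneForm_isVarpi hU hη hr hϖ hα hX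
    refine ⟨fun X hX => ⟨h.isVarpi_apply hU hη hr hϖ hα hX, hL X hX⟩, ?_⟩
    exact forall₂_congr fun X hX => by rw [hL X hX]
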